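/- Let $U\subset\mathbb{R}^n$ be open (the interior of the moment polytope, with coordinates $\mu_1,\dots,\mu_n$), let $\tau\in C^\infty(U,\mathbb{R})$ have positive definite Hessian $\phi_s=(\partial_{\mu_i}\partial_{\mu_j}\tau)$ on $U$, and let $C,F$ be constant antisymmetric real $n\times n$ matrices such that $\mathrm{I}+\frac14[(\phi_s)^{-1/2}F(\phi_s)^{-1/2}]^2$ is positive definite on $U$. Put $$\phi=\phi_s+C,\qquad \Xi=\phi_s+\tfrac14F(\phi_s)^{-1}F .$$ On $\mathring M=\mathbb{R}^n\times U$ with (admissible) coordinates $(\theta_i,\mu_i)$ let $\omega=\sum_i d\mu_i\wedge d\theta_i$ and $\zeta^\pm=d\theta\mp\frac12F\,d\mu$, and let $J_\pm$ be the complex structures determined by $$J_+^*\zeta^+=\phi^Td\mu,\quad J_+^*d\mu=-(\phi^T)^{-1}\zeta^+,\qquad J_-^*\zeta^-=\phi\,d\mu,\quad J_-^*d\mu=-\phi^{-1}\zeta^-,$$ where $(J^*\alpha)(X)=\alpha(JX)$. (This is the local form, on the open dense set where the torus acts freely, of a toric generalized Kähler structure of symplectic type.) Let $g(X,Y)=-\frac12\omega((J_++J_-)X,Y)$,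 $b(X,Y)=-\frac12\omega((J_+-J_-)X,Y)$, $H=db$, and let $\nabla^+$ be the Bismut connection $\nabla^+_XY=\nabla^{LC}_XY+\frac12g^{-1}H(X,Y)$, where $\nabla^{LC}$ is the Levi-Civita connection of the metric $g$, and $g^{-1}H(X,Y)$ is the vector field $V$ with $g(V,Z)=H(X,Y,Z)$ for all $Z$; we denote by $\nabla^+$ also the induced connection on $\Lambda^n(T\mathring M\otimes\mathbb{C})$, which contains the anticanonical bundle $K_+^{-1}=\Lambda^nT^{1,0}_+$ of $J_+$. Let $z_i^+$ be the $J_+$-holomorphic coordinates with $dz_i^+=\zeta_i^+-\sqrt{-1}J_+^*\zeta_i^+$, so that $\partial_{z_i^+}=\frac12(\partial_{\theta_i}-\sqrt{-1}J_+\partial_{\theta_i})$, and set $$\epsilon=\Big[\frac{\det(\phi_s\Xi)}{(\det\phi)^2}\Big]^{-1/2},\qquad s_0^+=\partial_{z_1^+}\wedge\cdots\wedge\partial_{z_n^+}.$$ Then $\epsilon s_0^+$ is a $J_-$-holomorphic section of $K_+^{-1}$ over $\mathring M$: it is a smooth section of $K_+^{-1}$, and $$\nabla^+_X(\epsilon s_0^+)=0\quad\text{for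 all } X\in T\mathring M\otimes\mathbb{C}\text{ with }J_-X=-\sqrt{-1}X .$$ -/

import Mathlib

open scoped ContDiff MatrixOrder

noncomputable section

namespace ToricGK

/-! ### Tensor calculus on an open set of a coordinate space

Points are `x : ι → ℝ`; a tensor field is given by its components in the coordinate frame `∂_a`. A
`2`-tensor `t` is the matrix `t a b = t(∂_a, ∂_b)`; an endomorphism `J` is the matrix with
`J ∂_b = ∑ a, J a b ∂_a`, so it acts on columns of components by `mulVec`, and its transpose `J^*` acts
on covectors, written as rows, by multiplication by `J` on the right. -/

section Calculus

set_option linter.unusedSectionVars false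

variable {ι : Type*} [Fintype ι] [DecidableEq ι]

/-- The partial derivative `∂_k f` at `x`. -/
def pd {V : Type*} [NormedAddCommGroup V] [NormedSpace ℝ V] (k : ι) (f : (ι → ℝ) → V) (x : ι → ℝ) : V :=
  fderiv ℝ f x (Pi.single k 1)

/-- The components `Γ^k_{ij}` of the Levi-Civita connection of `g`:
`∇_{∂_i} ∂_j = ∑ k, Γ^k_{ij} ∂_k`. -/
def leviCivita (g : (ι → ℝ) → Matrix ι ι ℝ) (x : ι → ℝ) (i j k : ι) : ℝ :=
  (1 / 2) * ∑ l, (g x)⁻¹ k l *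
    (pd i (fun y => g y j l) x + pd j (fun y => g y i l) x - pd l (fun y => g y i j) x)

/-- The exterior derivative of a `2`-form: `(db)(∂_i, ∂_j, ∂_l)`. -/
def dTwoForm (b : (ι → ℝ) → Matrix ι ι ℝ) (x : ι → ℝ) (i j l : ι) : ℝ :=
  pd i (fun y => b y j l) x + pd j (fun y => b y l i) x + pd l (fun y => b y i j) x

/-- The components of the Bismut connection `∇^+_X Y = ∇^{LC}_X Y + (1/2) g⁻¹ H(X, Y)` of a
metric `g` and a `3`-form `H`. -/
def bismutPlus (g : (ι → ℝ) → Matrix ι ι ℝ) (H : (ι → ℝ) → ι → ι → ι → ℝ)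
    (x : ι → ℝ) (i j k : ι) : ℝ :=
  leviCivita g x i j k + (1 / 2) * ∑ l, (g x)⁻¹ k l * H x i j l

/-- `T ⊗ ℂ` at a point: `X` stands for the complex tangent vector `∑ a, X a ∂_a`. The complexification
of an endomorphism `J` of `T` acts on it. -/
def actC (J : Matrix ι ι ℝ) (X : ι → ℂ) : ι → ℂ := (J.map Complex.ofReal).mulVec X

/-- `Λ^n (T ⊗ ℂ)` at a point: complex `n`-vectors, as alternating `n`-linear functions of covectors
(`α : ι → ℂ` stands for `∑ a, α a dx_a`). -/
abbrev MultiVector (ι : Type*) (n : ℕ) : Type _ := (ι → ℂ) [⋀^Fin n]→ₗ[ℂ] ℂ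

/-- `Z_1 ∧ ⋯ ∧ Z_n`. -/
def wedge {n : ℕ} (Z : Fin n → ι → ℂ) : MultiVector ι n :=
  Matrix.detRowAlternating.compLinearMap (Matrix.mulVecLin (Matrix.of Z))

theorem wedge_apply {n : ℕ} (Z α : Fin n → ι → ℂ) :
    wedge Z α = (Matrix.of fun i j => ∑ a, α i a * Z j a).det := by
  change Matrix.det _ = _
  congr 1
  ext i j
  simp [Matrix.mulVec, dotProduct, mul_comm]

/-- For a connection `Γ` on `T`, the covector `∇_X α` at `x`, where `α` has constant components and
`X` is a complex tangent vector at `x`: `(∇_X α)(∂_j) = - α(∇_X ∂_j)`. -/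
def covDerivCovector (Γ : (ι → ℝ) → ι → ι → ι → ℝ) (x : ι → ℝ) (X α : ι → ℂ) : ι → ℂ :=
  fun j => - ∑ i, ∑ k, X i * (Γ x i j k : ℂ) * α k

/-- The connection induced by `Γ` on `Λ^n (T ⊗ ℂ)`: the value of the `n`-vector `∇_X S` at `x` on the
covectors `α_1, …, α_n` (extended with constant components), by the Leibniz rule
`(∇_X S)(α_1, …, α_n) = X (S(α_1, …, α_n)) - ∑ m, S(α_1, …, ∇_X α_m, …, α_n)`. -/
def covDerivMultiVector {n : ℕ} (Γ : (ι → ℝ) → ι → ι → ι → ℝ) (S : (ι → ℝ) → MultiVector ι n)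
    (x : ι → ℝ) (X : ι → ℂ) (α : Fin n → ι → ℂ) : ℂ :=
  ∑ i, X i * pd i (fun y => S y α) x
    - ∑ m, S x (Function.update α m (covDerivCovector Γ x X (α m)))

/-- The fibre `Λ^n T^{1,0}` of the anticanonical bundle of an almost complex structure, inside
`Λ^n (T ⊗ ℂ)`. -/
def anticanonical (n : ℕ) (J : Matrix ι ι ℝ) : Submodule ℂ (MultiVector ι n) :=
  Submodule.span ℂ {s | ∃ Z : Fin n → ι → ℂ, (∀ m, actC J (Z m) = Complex.I • Z m) ∧ s = wedge Z}

/-- `S` is a smooth section over `W` of the anticanonical bundle of `Jp`, and it is annihilated by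
the part of type `(0,1)` with respect to `Jm` of the connection induced by `Γ`. -/
structure IsHolomorphicSection {n : ℕ} (W : Set (ι → ℝ)) (Jp Jm : (ι → ℝ) → Matrix ι ι ℝ)
    (Γ : (ι → ℝ) → ι → ι → ι → ℝ) (S : (ι → ℝ) → MultiVector ι n) : Prop where
  mem : ∀ x ∈ W, S x ∈ anticanonical n (Jp x)
  smooth : ∀ α : Fin n → ι → ℂ, ContDiffOn ℝ ∞ (fun x => S x α) W
  dbar_eq_zero : ∀ x ∈ W, ∀ X : ι → ℂ, actC (Jm x) X = (-Complex.I) • X →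
    ∀ α : Fin n → ι → ℂ, covDerivMultiVector Γ S x X α = 0

end Calculus

/-! ### Toric generalized Kähler structures of symplectic type in admissible coordinates

The coordinates are `θ_i` (index `inl i`) and `μ_i` (index `inr i`). -/

variable {n : ℕ}

/-- The point `μ` of the moment polytope below `x = (θ, μ)`. -/
def moment (x : Fin n ⊕ Fin n → ℝ) : Fin n → ℝ := fun i => x (Sum.inr i)

/-- `φ_s`, the Hessian of the symplectic potential. -/
def hess (τ : (Fin n → ℝ) → ℝ) (m : Fin n → ℝ) : Matrix (Fin n) (Fin n) ℝ :=
  Matrix.of fun i j => pd i (pd j τ) m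

/-- `φ = φ_s + C`. -/
def phi (τ : (Fin n → ℝ) → ℝ) (C : Matrix (Fin n) (Fin n) ℝ) (m : Fin n → ℝ) :
    Matrix (Fin n) (Fin n) ℝ :=
  hess τ m + C

/-- `Ξ = φ_s + (1/4) F (φ_s)⁻¹ F`. -/
def Xi (τ : (Fin n → ℝ) → ℝ) (F : Matrix (Fin n) (Fin n) ℝ) (m : Fin n → ℝ) :
    Matrix (Fin n) (Fin n) ℝ :=
  hess τ m + (1 / 4 : ℝ) • (F * (hess τ m)⁻¹ * F)

/-- The coframe `(ζ, dμ)` with `ζ = dθ - (1/2) F dμ`: its rows are these covectors in terms of `(dθ, dμ)`.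
For `F` it is `(ζ^+, dμ)`, and for `-F` it is `(ζ^-, dμ)`. -/
def coframe (F : Matrix (Fin n) (Fin n) ℝ) : Matrix (Fin n ⊕ Fin n) (Fin n ⊕ Fin n) ℝ :=
  Matrix.fromBlocks 1 (-((1 / 2 : ℝ) • F)) 0 1

/-- The matrix with blocks `0, ψ, -ψ⁻¹, 0`. -/
def stdJ (ψ : Matrix (Fin n) (Fin n) ℝ) : Matrix (Fin n ⊕ Fin n) (Fin n ⊕ Fin n) ℝ :=
  Matrix.fromBlocks 0 ψ (-ψ⁻¹) 0

/-- The endomorphism `J` of the tangent space with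
`J^* (ζ, dμ) = stdJ ψ (ζ, dμ)` for the coframe `(ζ, dμ)` of `F`; see `coframe_mul_endo`. -/
def endo (ψ F : Matrix (Fin n) (Fin n) ℝ) : Matrix (Fin n ⊕ Fin n) (Fin n ⊕ Fin n) ℝ :=
  (coframe F)⁻¹ * stdJ ψ * coframe F

theorem coframe_mul_endo (ψ F : Matrix (Fin n) (Fin n) ℝ) :
    coframe F * endo ψ F = stdJ ψ * coframe F := by
  have h : IsUnit (coframe F).det := by simp [coframe]
  rw [endo, ← mul_assoc, ← mul_assoc, Matrix.mul_nonsing_inv _ h, one_mul]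

/-- `J_+`: `J_+^* ζ^+ = φ^T dμ`, `J_+^* dμ = -(φ^T)⁻¹ ζ^+`. -/
def Jplus (τ : (Fin n → ℝ) → ℝ) (C F : Matrix (Fin n) (Fin n) ℝ) (x : Fin n ⊕ Fin n → ℝ) :
    Matrix (Fin n ⊕ Fin n) (Fin n ⊕ Fin n) ℝ :=
  endo (phi τ C (moment x)).transpose F

/-- `J_-`: `J_-^* ζ^- = φ dμ`, `J_-^* dμ = -φ⁻¹ ζ^-`. -/
def Jminus (τ : (Fin n → ℝ) → ℝ) (C F : Matrix (Fin n) (Fin n) ℝ) (x : Fin n ⊕ Fin n → ℝ) :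
    Matrix (Fin n ⊕ Fin n) (Fin n ⊕ Fin n) ℝ :=
  endo (phi τ C (moment x)) (-F)

/-- The symplectic form `ω = ∑ i, dμ_i ∧ dθ_i`. -/
def omega (n : ℕ) : Matrix (Fin n ⊕ Fin n) (Fin n ⊕ Fin n) ℝ :=
  Matrix.fromBlocks 0 (-1) 1 0

/-- The metric `g = -(1/2) ω (J_+ + J_-)`, that is `g(X, Y) = -(1/2) ω((J_+ + J_-) X, Y)`. -/
def metric (τ : (Fin n → ℝ) → ℝ) (C F : Matrix (Fin n) (Fin n) ℝ) (x : Fin n ⊕ Fin n → ℝ) :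
    Matrix (Fin n ⊕ Fin n) (Fin n ⊕ Fin n) ℝ :=
  -((1 / 2 : ℝ) • ((Jplus τ C F x + Jminus τ C F x).transpose * omega n))

/-- The `2`-form `b = -(1/2) ω (J_+ - J_-)`. -/
def bField (τ : (Fin n → ℝ) → ℝ) (C F : Matrix (Fin n) (Fin n) ℝ) (x : Fin n ⊕ Fin n → ℝ) :
    Matrix (Fin n ⊕ Fin n) (Fin n ⊕ Fin n) ℝ :=
  -((1 / 2 : ℝ) • ((Jplus τ C F x - Jminus τ C F x).transpose * omega n))

/-- The Bismut connection `∇^+`, with the `3`-form `H = db`. -/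
def nablaPlus (τ : (Fin n → ℝ) → ℝ) (C F : Matrix (Fin n) (Fin n) ℝ) :
    (Fin n ⊕ Fin n → ℝ) → Fin n ⊕ Fin n → Fin n ⊕ Fin n → Fin n ⊕ Fin n → ℝ :=
  bismutPlus (metric τ C F) (dTwoForm (bField τ C F))

/-- The covector `dz_i^+ = ζ_i^+ - √-1 J_+^* ζ_i^+`. -/
def dzPlus (τ : (Fin n → ℝ) → ℝ) (C F : Matrix (Fin n) (Fin n) ℝ) (x : Fin n ⊕ Fin n → ℝ)
    (i : Fin n) : Fin n ⊕ Fin n → ℂ :=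
  fun a => (coframe F (Sum.inl i) a : ℂ) -
    Complex.I * ((coframe F * Jplus τ C F x) (Sum.inl i) a : ℂ)

/-- The vector `∂_{z_i^+} = (1/2) (∂_{θ_i} - √-1 J_+ ∂_{θ_i})`. Together with the complex
conjugates it is the frame dual to `dz_i^+`, `d\bar z_i^+`: see `dzPlus_delz` and `conj_dzPlus_delz`. -/
def delzPlus (τ : (Fin n → ℝ) → ℝ) (C F : Matrix (Fin n) (Fin n) ℝ) (x : Fin n ⊕ Fin n → ℝ)
    (i : Fin n) : Fin n ⊕ Fin n → ℂ :=
  (1 / 2 : ℂ) • (Pi.single (Sum.inl i) 1 -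
    Complex.I • actC (Jplus τ C F x) (Pi.single (Sum.inl i) 1))

/-- `ε = [det(φ_s Ξ) / (det φ)^2]^{-1/2}`. -/
def eps (τ : (Fin n → ℝ) → ℝ) (C F : Matrix (Fin n) (Fin n) ℝ) (m : Fin n → ℝ) : ℝ :=
  ((hess τ m * Xi τ F m).det / (phi τ C m).det ^ 2) ^ (-(1 / 2) : ℝ)

theorem endo_mul_self (ψ F : Matrix (Fin n) (Fin n) ℝ) (h : IsUnit ψ.det) :
    endo ψ F * endo ψ F = -1 := by
  have hc : IsUnit (coframe F).det := by simp [coframe]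
  have hN : stdJ ψ * stdJ ψ = -1 := by
    simp [stdJ, Matrix.fromBlocks_multiply, Matrix.mul_nonsing_inv _ h, Matrix.nonsing_inv_mul _ h,
      ← Matrix.fromBlocks_one, Matrix.fromBlocks_neg]
  calc endo ψ F * endo ψ F = (coframe F)⁻¹ * stdJ ψ * (coframe F * endo ψ F) := by
        simp only [endo, mul_assoc]
    _ = (coframe F)⁻¹ * (stdJ ψ * stdJ ψ) * coframe F := by
        rw [coframe_mul_endo]; simp only [mul_assoc]
    _ = -1 := by rw [hN]; simp [Matrix.nonsing_inv_mul _ hc]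

theorem coframe_endo_inl (ψ F : Matrix (Fin n) (Fin n) ℝ) (i j : Fin n) :
    (coframe F * endo ψ F) (Sum.inl j) (Sum.inl i) = 0 := by
  rw [coframe_mul_endo]
  simp [coframe, stdJ, Matrix.fromBlocks_multiply]

theorem sum_endo (ψ F : Matrix (Fin n) (Fin n) ℝ) (h : IsUnit ψ.det) (i j : Fin n) :
    ∑ a, (coframe F * endo ψ F) (Sum.inl j) a * endo ψ F a (Sum.inl i) =
      if j = i then -1 else 0 := by
  rw [← Matrix.mul_apply, mul_assoc, endo_mul_self ψ F h]
  by_cases hij : j = i <;> simp [coframe, hij]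

theorem sum_coframe (ψ F : Matrix (Fin n) (Fin n) ℝ) (i j : Fin n) :
    ∑ a, coframe F (Sum.inl j) a * endo ψ F a (Sum.inl i) = 0 := by
  rw [← Matrix.mul_apply, coframe_endo_inl]

theorem sum_delz (τ : (Fin n → ℝ) → ℝ) (C F : Matrix (Fin n) (Fin n) ℝ)
    (x : Fin n ⊕ Fin n → ℝ) (h : IsUnit (phi τ C (moment x)).det) (i j : Fin n) (c : ℂ) :
    ∑ a, ((coframe F (Sum.inl j) a : ℂ) + c * ((coframe F * Jplus τ C F x) (Sum.inl j) a : ℂ)) *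
      delzPlus τ C F x i a = if j = i then (1 + Complex.I * c) / 2 else 0 := by
  have h' : IsUnit (phi τ C (moment x)).transpose.det := by rwa [Matrix.det_transpose]
  have e1 := congrArg (fun r : ℝ => (r : ℂ)) (sum_endo _ F h' i j)
  have e2 := congrArg (fun r : ℝ => (r : ℂ)) (sum_coframe (phi τ C (moment x)).transpose F i j)
  have e3 := congrArg (fun r : ℝ => (r : ℂ)) (coframe_endo_inl (phi τ C (moment x)).transpose F i j)
  have e4 : (coframe F (Sum.inl j) (Sum.inl i) : ℂ) = if j = i then 1 else 0 := by
    by_cases hij : j = i <;> simp [coframe, hij]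
  have key : ∀ (f : Fin n ⊕ Fin n → ℂ), ∑ a, f a * delzPlus τ C F x i a =
      (1 / 2) * (f (Sum.inl i) - Complex.I * ∑ a, f a * (Jplus τ C F x a (Sum.inl i) : ℂ)) := by
    intro f
    have : ∀ a, f a * delzPlus τ C F x i a =
        (1 / 2) * (f a * (Pi.single (Sum.inl i) 1 : Fin n ⊕ Fin n → ℂ) a) -
        (1 / 2) * Complex.I * (f a * (Jplus τ C F x a (Sum.inl i) : ℂ)) := by
      intro a
      simp [delzPlus, actC]
      ring
    simp_rw [this, Finset.sum_sub_distrib, ← Finset.mul_sum]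
    rw [show ∑ a, f a * (Pi.single (Sum.inl i) 1 : Fin n ⊕ Fin n → ℂ) a = f (Sum.inl i) by
      simp [Pi.single_apply]]
    ring
  rw [key]
  simp only [add_mul, mul_assoc, Finset.sum_add_distrib, ← Finset.mul_sum]
  simp only [Jplus] at *
  push_cast at e1 e2 e3
  rw [e1, e2, e3, e4]
  by_cases hij : j = i <;> simp [hij]
  ring

theorem dzPlus_delz (τ : (Fin n → ℝ) → ℝ) (C F : Matrix (Fin n) (Fin n) ℝ)
    (x : Fin n ⊕ Fin n → ℝ) (h : IsUnit (phi τ C (moment x)).det) (i j : Fin n) :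
    ∑ a, dzPlus τ C F x j a * delzPlus τ C F x i a = if j = i then 1 else 0 := by
  have := sum_delz τ C F x h i j (-Complex.I)
  simp only [neg_mul, ← sub_eq_add_neg] at this
  simp only [dzPlus]
  rw [this]
  simp

theorem conj_dzPlus_delz (τ : (Fin n → ℝ) → ℝ) (C F : Matrix (Fin n) (Fin n) ℝ)
    (x : Fin n ⊕ Fin n → ℝ) (h : IsUnit (phi τ C (moment x)).det) (i j : Fin n) :
    ∑ a, (starRingEnd ℂ) (dzPlus τ C F x j a) * delzPlus τ C F x i a = 0 := by
  have := sum_delz τ C F x h i j Complex.I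
  simp only [dzPlus, map_sub, map_mul, Complex.conj_ofReal, Complex.conj_I, neg_mul, sub_neg_eq_add]
  rw [this]
  simp

end ToricGK

end

/-! Write `S` for `φ_s`. The antisymmetry of `F` makes `J_+` minus the `ω`-adjoint of `J_-`, so `e =
g + b` is simply `ω J_-`. Hence `e + √-1 ω = ω (J_- + √-1)` factors as `R η`, where `η = dz^-`
consists of the closed `J_-`-holomorphic forms `ζ^- - √-1 J_-^* ζ^-`; and its transpose is `ω (J_+ -
√-1)`, whose kernel is `T^{1,0}_+`.

Let `Y` be the frame of `T^{1,0}_+` dual to `dz^-` (`flatFrame`). It exists because `T^{1,0}_+` and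
`T^{0,1}_-` are transverse, which amounts to invertibility of the Hermitian matrix `E = S + (√-1/2)
F`. Differentiating the identities `e + √-1 ω = R η`, `(e + √-1 ω)ᵀ Y = 0` and `η Y = 1`, and using
`dη = 0`, gives `∇^+_X Y = 0` for `X` in `T^{0,1}_-` (`lowered_parallel`, `covDeriv_frame_eq_zero`).
So `Y_1 ∧ ⋯ ∧ Y_n` is annihilated by the same derivatives (`covDerivMultiVector_wedge_eq_zero`).

It remains to identify this wedge with `ε s_0^+`. The change of frame from `Y` to `∂_{z^+}` is `E
(φᵀ)⁻¹` (`delzPlus_eq`). Its determinant is `1/ε`: from `E S⁻¹ Eᵀ = Ξ` one gets `(det E)² = det(S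
Ξ)`, while `det E` and `det φ` are positive by deformation to `det S` (`det_hermitianPart_pos`,
`det_add_pos`). -/

noncomputable section

namespace ToricGK

variable {n : ℕ}

/-! ### Complexification of real matrices -/

section Complexify

variable {l m k : Type*}

/-- A real matrix, seen as a complex one. -/
def complexify (A : Matrix l m ℝ) : Matrix l m ℂ := A.map Complex.ofReal

@[simp] theorem complexify_apply (A : Matrix l m ℝ) (i : l) (j : m) :
    complexify A i j = (A i j : ℂ) := rfl

theorem complexify_add (A B : Matrix l m ℝ) :
    complexify (A + B) = complexify A + complexify B := by ext; simp

theorem complexify_sub (A B : Matrix l m ℝ) :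
    complexify (A - B) = complexify A - complexify B := by ext; simp

theorem complexify_neg (A : Matrix l m ℝ) : complexify (-A) = -complexify A := by ext; simp

theorem complexify_smul (c : ℝ) (A : Matrix l m ℝ) :
    complexify (c • A) = (c : ℂ) • complexify A := by ext; simp

theorem complexify_mul [Fintype m] (A : Matrix l m ℝ) (B : Matrix m k ℝ) :
    complexify (A * B) = complexify A * complexify B := by
  ext; simp [Matrix.mul_apply]

theorem complexify_one [DecidableEq m] : complexify (1 : Matrix m m ℝ) = 1 := by
  ext i j; by_cases h : i = j <;> simp [Matrix.one_apply, h]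

theorem complexify_transpose (A : Matrix l m ℝ) :
    complexify A.transpose = (complexify A).transpose := rfl

theorem complexify_fromBlocks {o : Type*} (A : Matrix l m ℝ) (B : Matrix l k ℝ)
    (C : Matrix o m ℝ) (D : Matrix o k ℝ) : complexify (Matrix.fromBlocks A B C D) =
      Matrix.fromBlocks (complexify A) (complexify B) (complexify C) (complexify D) := by
  ext (_ | _) (_ | _) <;> simp

theorem det_complexify [Fintype m] [DecidableEq m] (A : Matrix m m ℝ) :
    (complexify A).det = (A.det : ℂ) := (Complex.ofRealHom.map_det A).symm

theorem complexify_mul_inv [Fintype m] [DecidableEq m] {A : Matrix m m ℝ} (h : IsUnit A.det) :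
    complexify A * complexify A⁻¹ = 1 := by
  rw [← complexify_mul, Matrix.mul_nonsing_inv _ h, complexify_one]

theorem complexify_inv_mul [Fintype m] [DecidableEq m] {A : Matrix m m ℝ} (h : IsUnit A.det) :
    complexify A⁻¹ * complexify A = 1 := by
  rw [← complexify_mul, Matrix.nonsing_inv_mul _ h, complexify_one]

end Complexify

/-! ### The endomorphism `endo` in blocks -/

theorem coframe_inv (F : Matrix (Fin n) (Fin n) ℝ) : (coframe F)⁻¹ = coframe (-F) := by
  apply Matrix.inv_eq_right_inv
  simp [coframe, Matrix.fromBlocks_multiply]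

theorem endo_eq_fromBlocks (ψ F : Matrix (Fin n) (Fin n) ℝ) :
    endo ψ F = Matrix.fromBlocks (-((1 / 2 : ℝ) • (F * ψ⁻¹)))
      (ψ + (1 / 4 : ℝ) • (F * ψ⁻¹ * F)) (-ψ⁻¹) ((1 / 2 : ℝ) • (ψ⁻¹ * F)) := by
  rw [endo, coframe_inv]
  simp only [coframe, stdJ, Matrix.fromBlocks_multiply]
  congr 1 <;> simp [smul_smul, Matrix.mul_assoc, add_comm]
  norm_num

/-- With `ψ = φ` this is `ω(J_+ X, Y) = -ω(X, J_- Y)`: passing to the `ω`-adjoint transposes `φ` and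
flips the sign of `F`, up to an overall sign. -/
theorem transpose_endo_mul_omega (ψ F : Matrix (Fin n) (Fin n) ℝ) (hF : F.transpose = -F) :
    (endo ψ.transpose F).transpose * omega n = -(omega n * endo ψ (-F)) := by
  rw [endo_eq_fromBlocks, endo_eq_fromBlocks, omega]
  simp only [Matrix.fromBlocks_transpose, Matrix.fromBlocks_multiply, Matrix.fromBlocks_neg]
  congr 1 <;> simp [Matrix.transpose_nonsing_inv, hF, Matrix.mul_assoc]

/-- The `1`-forms `ζ - c J^* ζ`, where `c = ± √-1`. -/
def holCoframe (c : ℂ) (ψ F : Matrix (Fin n) (Fin n) ℝ) : Matrix (Fin n) (Fin n ⊕ Fin n) ℂ :=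
  Matrix.fromCols 1 (-((1 / 2 : ℂ) • complexify F) - c • complexify ψ)

/-- The factor `Q` in `J + c = Q (ζ - c J^* ζ)`. -/
def holFactor (c : ℂ) (ψ F : Matrix (Fin n) (Fin n) ℝ) : Matrix (Fin n ⊕ Fin n) (Fin n) ℂ :=
  Matrix.fromRows (-((1 / 2 : ℂ) • (complexify F * complexify ψ⁻¹)) + c • 1) (-complexify ψ⁻¹)

theorem holFactor_mul_holCoframe {c : ℂ} (hc : c * c = -1) {ψ : Matrix (Fin n) (Fin n) ℝ}
    (h : IsUnit ψ.det) (F : Matrix (Fin n) (Fin n) ℝ) :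
    holFactor c ψ F * holCoframe c ψ F = complexify (endo ψ F) + c • 1 := by
  have h1 := complexify_inv_mul h
  rw [endo_eq_fromBlocks, complexify_fromBlocks, ← Matrix.fromBlocks_one, Matrix.fromBlocks_smul,
    Matrix.fromBlocks_add, holFactor, holCoframe, Matrix.fromRows_mul_fromCols]
  simp only [complexify_add, complexify_smul, complexify_mul, complexify_neg]
  congr 1
  · simp
  · simp only [Matrix.add_mul, Matrix.mul_sub, Matrix.neg_mul, Matrix.mul_neg, Matrix.smul_mul,
      Matrix.mul_smul, Matrix.mul_assoc, h1, Matrix.mul_one, Matrix.one_mul]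
    simp only [smul_add, smul_neg, smul_smul, hc]
    push_cast
    module
  · simp
  · simp only [Matrix.mul_sub, Matrix.neg_mul, Matrix.mul_neg,
      Matrix.mul_smul, h1]
    push_cast
    module

theorem holCoframe_mulVec_eq_zero {c : ℂ} (hc : c * c = -1) {ψ : Matrix (Fin n) (Fin n) ℝ}
    (h : IsUnit ψ.det) (F : Matrix (Fin n) (Fin n) ℝ) {X : Fin n ⊕ Fin n → ℂ}
    (hX : actC (endo ψ F) X = (-c) • X) : (holCoframe c ψ F).mulVec X = 0 := by
  have h0 : (holFactor c ψ F).mulVec ((holCoframe c ψ F).mulVec X) = 0 := by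
    rw [Matrix.mulVec_mulVec, holFactor_mul_holCoframe hc h, Matrix.add_mulVec, Matrix.smul_mulVec,
      Matrix.one_mulVec]
    change actC (endo ψ F) X + _ = 0
    rw [hX, neg_smul, neg_add_cancel]
  set v := (holCoframe c ψ F).mulVec X
  -- The lower block `-ψ⁻¹` alone already makes `holFactor` injective.
  have h1 : (complexify ψ⁻¹).mulVec v = 0 := by
    rw [holFactor, Matrix.fromRows_mulVec] at h0
    have := congrArg (fun f => f ∘ Sum.inr) h0
    simpa [Matrix.neg_mulVec] using this
  rw [← Matrix.one_mulVec v, ← complexify_mul_inv h, ← Matrix.mulVec_mulVec, h1, Matrix.mulVec_zero]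

/-- The Hermitian matrix `S + (√-1/2) F`. -/
def hermitianPart (S F : Matrix (Fin n) (Fin n) ℝ) : Matrix (Fin n) (Fin n) ℂ :=
  complexify S + (Complex.I / 2) • complexify F

/-- The projections of the vectors `∂_{θ_j}` to `T^{1,0}_+` along `T^{0,1}_-`, as columns. -/
def flatFrame (S C F : Matrix (Fin n) (Fin n) ℝ) : Matrix (Fin n ⊕ Fin n) (Fin n) ℂ :=
  Matrix.fromRows ((1 / 2 : ℂ) • (hermitianPart (S - C) F * (hermitianPart S F)⁻¹))
    ((Complex.I / 2) • (hermitianPart S F)⁻¹)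

/-- The coframe is `dz^-`. This and the vanishing of the conjugate of `dz^+` on the same frame,
proved next, characterize `flatFrame`. -/
theorem holCoframe_mul_flatFrame {S C F : Matrix (Fin n) (Fin n) ℝ}
    (h : IsUnit (hermitianPart S F).det) :
    holCoframe Complex.I (S + C) (-F) * flatFrame S C F = 1 := by
  rw [holCoframe, flatFrame, Matrix.fromCols_mul_fromRows, Matrix.one_mul, Matrix.mul_smul,
    ← Matrix.smul_mul, ← Matrix.smul_mul, ← Matrix.add_mul]
  conv_rhs => rw [← Matrix.mul_nonsing_inv _ h]
  congr 1
  simp only [hermitianPart, complexify_add, complexify_sub, complexify_neg]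
  simp only [smul_add, smul_sub, smul_smul, smul_neg, neg_neg]
  have : Complex.I / 2 * Complex.I = -(1/2) := by
    rw [div_mul_eq_mul_div, Complex.I_mul_I]; norm_num
  simp only [this]
  module

theorem holCoframe_mul_flatFrame_eq_zero {S C F : Matrix (Fin n) (Fin n) ℝ} :
    holCoframe (-Complex.I) (S - C) F * flatFrame S C F = 0 := by
  rw [holCoframe, flatFrame, Matrix.fromCols_mul_fromRows, Matrix.one_mul, Matrix.mul_smul,
    ← Matrix.smul_mul, ← Matrix.smul_mul, ← Matrix.add_mul]
  conv_rhs => rw [← Matrix.zero_mul (hermitianPart S F)⁻¹]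
  congr 1
  simp only [hermitianPart, smul_add, smul_sub, smul_smul, smul_neg]
  have : Complex.I / 2 * -Complex.I = (1/2) := by
    rw [div_mul_eq_mul_div, mul_neg, Complex.I_mul_I]; norm_num
  simp only [this]
  module

theorem endo_mul_flatFrame {S C : Matrix (Fin n) (Fin n) ℝ} (h : IsUnit (S - C).det)
    (F : Matrix (Fin n) (Fin n) ℝ) :
    complexify (endo (S - C) F) * flatFrame S C F = Complex.I • flatFrame S C F := by
  have h1 := holFactor_mul_holCoframe (c := -Complex.I) (by simp) h F
  have h2 := congrArg (· * flatFrame S C F) h1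
  simp only [Matrix.mul_assoc, holCoframe_mul_flatFrame_eq_zero, Matrix.mul_zero, Matrix.add_mul,
    neg_smul, Matrix.neg_mul, Matrix.smul_mul, Matrix.one_mul] at h2
  exact (sub_eq_zero.mp (by rw [sub_eq_add_neg]; exact h2.symm))

/-! ### Transversality of `T^{1,0}_+` and `T^{0,1}_-`, and nondegeneracy of `J_+ + J_-`. -/

/-- Both coframes have the same `dθ` part, and `C` cancels in the difference of their `dμ` parts,
which is `-2√-1 (S + (√-1/2) F)`. This forces the `μ`-components to vanish, and then the
`θ`-components. -/
theorem eq_zero_of_holCoframe {S C F : Matrix (Fin n) (Fin n) ℝ}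
    (h : IsUnit (hermitianPart S F).det) {W : Fin n ⊕ Fin n → ℂ}
    (h1 : (holCoframe (-Complex.I) (S - C) F).mulVec W = 0)
    (h2 : (holCoframe Complex.I (S + C) (-F)).mulVec W = 0) : W = 0 := by
  obtain ⟨u, v, rfl⟩ : ∃ u v, W = Sum.elim u v := ⟨W ∘ Sum.inl, W ∘ Sum.inr, by simp⟩
  simp only [holCoframe, Matrix.fromCols_mulVec, Sum.elim_comp_inl, Sum.elim_comp_inr,
    Matrix.one_mulVec] at h1 h2
  have h3 : (hermitianPart S F).mulVec v = 0 := by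
    have h4 : ((-(2 * Complex.I)) • hermitianPart S F).mulVec v = 0 := by
      have h5 := congrArg₂ (· - ·) h2 h1
      simp only [add_sub_add_left_eq_sub, ← Matrix.sub_mulVec, sub_zero] at h5
      rw [← h5]
      congr 1
      simp only [hermitianPart, complexify_add, complexify_sub, complexify_neg, smul_add, smul_smul]
      have : -(2 * Complex.I) * (Complex.I / 2) = 1 := by
        linear_combination -Complex.I_mul_I
      rw [this]
      module
    rw [Matrix.smul_mulVec] at h4
    exact (smul_eq_zero.mp h4).resolve_left (by simp)
  have hv : v = 0 := by
    rw [← Matrix.one_mulVec v, ← Matrix.nonsing_inv_mul _ h, ← Matrix.mulVec_mulVec, h3,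
      Matrix.mulVec_zero]
  subst hv
  have hu : u = 0 := by simpa using h1
  subst hu
  simp

/-- This gives nondegeneracy of `g`, without which the matrix inverse in the connection would not
invert it. A real kernel vector of `J_+ + J_-` would produce a nonzero vector of `T^{1,0}_+ ∩
T^{0,1}_-`. -/
theorem isUnit_det_endo_add_endo {S C F : Matrix (Fin n) (Fin n) ℝ}
    (hA : IsUnit (S - C).det) (hB : IsUnit (S + C).det)
    (h : IsUnit (hermitianPart S F).det) :
    IsUnit (endo (S - C) F + endo (S + C) (-F)).det := by
  rw [isUnit_iff_ne_zero]
  intro h0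
  obtain ⟨v, hv0, hv⟩ := Matrix.exists_mulVec_eq_zero_iff.mpr h0
  rw [Matrix.add_mulVec] at hv
  set J := endo (S - C) F
  set J' := endo (S + C) (-F)
  have hJ : J * J = -1 := endo_mul_self _ _ hA
  have hJ' : J' * J' = -1 := endo_mul_self _ _ hB
  have act : ∀ (A : Matrix (Fin n ⊕ Fin n) (Fin n ⊕ Fin n) ℝ) (w : Fin n ⊕ Fin n → ℝ),
      actC A (fun a => (w a : ℂ)) = fun a => ((A.mulVec w a : ℝ) : ℂ) := by
    intro A w; ext a; simp [actC, Matrix.mulVec, dotProduct]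
  have act2 : ∀ (A : Matrix (Fin n ⊕ Fin n) (Fin n ⊕ Fin n) ℝ) (X Y : Fin n ⊕ Fin n → ℂ) (c : ℂ),
      actC A (X + c • Y) = actC A X + c • actC A Y := by
    intro A X Y c; simp [actC, Matrix.mulVec_add, Matrix.mulVec_smul]
  -- The two expressions `v - √-1 J v` and `v + √-1 J' v` coincide since `J v = -J' v`; the first is
  -- of type `(1,0)` for `J`, the second of type `(0,1)` for `J'`.
  let W : Fin n ⊕ Fin n → ℂ := (fun a => (v a : ℂ)) + (-Complex.I) • fun a => (J.mulVec v a : ℂ)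
  have hW' : W = (fun a => (v a : ℂ)) + Complex.I • fun a => (J'.mulVec v a : ℂ) := by
    have : J.mulVec v = - J'.mulVec v := eq_neg_of_add_eq_zero_left hv
    ext a
    simp [W, this]
  have k1 : actC J W = (-(-Complex.I)) • W := by
    rw [act2, act, act, Matrix.mulVec_mulVec, hJ, Matrix.neg_mulVec, Matrix.one_mulVec]
    ext a
    simp only [W, Pi.add_apply, Pi.smul_apply, smul_eq_mul, Pi.neg_apply]
    push_cast
    linear_combination (J.mulVec v a : ℂ) * Complex.I_mul_I
  have k2 : actC J' W = (-Complex.I) • W := by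
    rw [hW', act2, act, act, Matrix.mulVec_mulVec, hJ', Matrix.neg_mulVec, Matrix.one_mulVec]
    ext a
    simp only [Pi.add_apply, Pi.smul_apply, smul_eq_mul, Pi.neg_apply]
    push_cast
    linear_combination (J'.mulVec v a : ℂ) * Complex.I_mul_I
  have hW : W = 0 := eq_zero_of_holCoframe h
    (holCoframe_mulVec_eq_zero (by simp) hA F k1)
    (holCoframe_mulVec_eq_zero (by simp) hB (-F) k2)
  apply hv0
  ext a
  have := congrArg Complex.re (congrFun hW a)
  simpa [W] using this

/-! ### Positivity -/

theorem pos_of_ne_zero_on_Icc {f : ℝ → ℝ} (hf : Continuous f) (h0 : 0 < f 0)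
    (h : ∀ t ∈ Set.Icc (0 : ℝ) 1, f t ≠ 0) : 0 < f 1 := by
  by_contra h1
  obtain ⟨t, ht, ht0⟩ := intermediate_value_Icc' zero_le_one hf.continuousOn
    (show (0 : ℝ) ∈ Set.Icc (f 1) (f 0) from ⟨not_lt.mp h1, h0.le⟩)
  exact h t ht ht0

/-- Along `S + t C` the quadratic form stays that of `S`, because `C` contributes nothing to it; so
the determinant never vanishes and keeps its sign at `t = 0`. -/
theorem det_add_pos {S C : Matrix (Fin n) (Fin n) ℝ} (hS : S.PosDef) (hC : C.transpose = -C) :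
    0 < (S + C).det := by
  have hne : ∀ t : ℝ, (S + t • C).det ≠ 0 := by
    intro t h0
    obtain ⟨v, hv0, hv⟩ := Matrix.exists_mulVec_eq_zero_iff.mpr h0
    have h1 : v ⬝ᵥ C.mulVec v = 0 := by
      have : v ⬝ᵥ C.mulVec v = - (v ⬝ᵥ C.mulVec v) := by
        conv_lhs => rw [Matrix.dotProduct_mulVec, ← Matrix.mulVec_transpose, hC, dotProduct_comm,
          Matrix.neg_mulVec, dotProduct_neg]
      linarith
    have h2 := hS.dotProduct_mulVec_pos hv0
    have h3 := congrArg (v ⬝ᵥ ·) hv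
    simp only [Matrix.add_mulVec, Matrix.smul_mulVec, dotProduct_add, dotProduct_smul, h1,
      dotProduct_zero] at h3
    simp at h2 h3
    linarith
  have := pos_of_ne_zero_on_Icc (f := fun t : ℝ => (S + t • C).det) (by fun_prop)
    (by simpa using hS.det_pos) (fun t _ => hne t)
  simpa using this

theorem hermitianPart_mul_mul {S : Matrix (Fin n) (Fin n) ℝ} (hS : IsUnit S.det)
    (F : Matrix (Fin n) (Fin n) ℝ) :
    hermitianPart S F * complexify S⁻¹ * hermitianPart S (-F) =
      complexify (S + (1 / 4 : ℝ) • (F * S⁻¹ * F)) := by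
  have h1 := complexify_mul_inv hS
  have h2 := complexify_inv_mul hS
  simp only [hermitianPart, complexify_add, complexify_smul, complexify_mul, complexify_neg,
    Matrix.add_mul, Matrix.mul_add, h1, Matrix.smul_mul, Matrix.mul_smul, Matrix.mul_neg,
    Matrix.mul_assoc, h2, Matrix.one_mul, Matrix.mul_one]
  simp only [smul_neg, smul_add, smul_smul]
  have : Complex.I / 2 * (Complex.I / 2) = -(1 / 4) := by
    linear_combination Complex.I_mul_I / 4
  rw [this]
  push_cast
  module

theorem hermitianPart_transpose {S F : Matrix (Fin n) (Fin n) ℝ} (hS : S.transpose = S)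
    (hF : F.transpose = -F) : (hermitianPart S F).transpose = hermitianPart S (-F) := by
  rw [hermitianPart, hermitianPart, Matrix.transpose_add, Matrix.transpose_smul,
    ← complexify_transpose, ← complexify_transpose, hS, hF]

/-- The entrywise conjugate of the matrix is its transpose. -/
theorem det_hermitianPart_im {S F : Matrix (Fin n) (Fin n) ℝ} (hS : S.transpose = S)
    (hF : F.transpose = -F) : (hermitianPart S F).det.im = 0 := by
  rw [← Complex.conj_eq_iff_im]
  rw [RingHom.map_det]
  conv_rhs => rw [← Matrix.det_transpose, hermitianPart_transpose hS hF]
  congr 1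
  ext i j
  have h2 : (starRingEnd ℂ) 2 = 2 := Complex.conj_ofReal 2
  simp [hermitianPart, Complex.conj_I, h2]
  ring

theorem det_hermitianPart_sq {S F : Matrix (Fin n) (Fin n) ℝ} (hS : S.transpose = S)
    (hS' : IsUnit S.det) (hF : F.transpose = -F) :
    (hermitianPart S F).det ^ 2 = ((S * (S + (1 / 4 : ℝ) • (F * S⁻¹ * F))).det : ℂ) := by
  rw [Matrix.det_mul, Complex.ofReal_mul, ← det_complexify (S + _), ← hermitianPart_mul_mul hS',
    ← hermitianPart_transpose hS hF, Matrix.det_mul, Matrix.det_mul, Matrix.det_transpose]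
  have h := congrArg Matrix.det (complexify_mul_inv hS')
  rw [Matrix.det_mul, det_complexify, Matrix.det_one] at h
  linear_combination - ((hermitianPart S F).det ^ 2) * h

/-- Deform `F` to `t F`. The determinant stays real, and its square is `det S` times the determinant
of a convex combination of `S` and `Ξ`, hence nonzero on `[0, 1]`. -/
theorem det_hermitianPart_pos {S F : Matrix (Fin n) (Fin n) ℝ} (hS : S.PosDef)
    (hF : F.transpose = -F) (hX : (S + (1 / 4 : ℝ) • (F * S⁻¹ * F)).PosDef) :
    0 < (hermitianPart S F).det.re := by
  have hSt : S.transpose = S := by simpa using hS.isHermitian.eq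
  have hSu : IsUnit S.det := isUnit_iff_ne_zero.mpr hS.det_pos.ne'
  have key := pos_of_ne_zero_on_Icc
    (f := fun t : ℝ => (complexify S + ((t : ℂ) * (Complex.I / 2)) • complexify F).det.re)
    (by fun_prop) (by simpa [det_complexify] using hS.det_pos) ?_
  · simpa [hermitianPart] using key
  intro t ht h0
  have he : complexify S + ((t : ℂ) * (Complex.I / 2)) • complexify F = hermitianPart S (t • F) := by
    rw [hermitianPart, complexify_smul, smul_smul, mul_comm]
  simp only [he] at h0
  have htF : (t • F).transpose = -(t • F) := by rw [Matrix.transpose_smul, hF, smul_neg]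
  have hdet : (hermitianPart S (t • F)).det = 0 :=
    Complex.ext h0 (det_hermitianPart_im hSt htF)
  have hsq := det_hermitianPart_sq hSt hSu htF
  rw [hdet] at hsq
  have hp : (S + (1 / 4 : ℝ) • (t • F * S⁻¹ * t • F)).PosDef := by
    have e : S + (1 / 4 : ℝ) • (t • F * S⁻¹ * t • F) =
        (1 - t ^ 2) • S + t ^ 2 • (S + (1 / 4 : ℝ) • (F * S⁻¹ * F)) := by
      simp only [Matrix.smul_mul, Matrix.mul_smul]
      module
    rw [e]
    -- The weight `1 - t²` of `S` vanishes at `t = 1`, so that term is used only as semidefinite;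
    -- definiteness comes from the second term, which needs `t > 0`.
    rcases eq_or_lt_of_le ht.1 with rfl | h0t
    · simpa using hS
    · exact Matrix.PosDef.posSemidef_add
        (hS.posSemidef.smul (by nlinarith [ht.1, ht.2])) (hX.smul (by positivity))
  rw [Matrix.det_mul] at hsq
  have := mul_pos hS.det_pos hp.det_pos
  have hz : (0 : ℝ) = S.det * (S + (1 / 4 : ℝ) • (t • F * S⁻¹ * t • F)).det := by
    exact_mod_cast (by simpa using hsq)
  linarith

/-- Congruence by `T = S^{1/2}`: `Ξ = T (1 + (1/4) (T⁻¹ F T⁻¹)²) T`. -/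
theorem posDef_add_of_sqrt {S F : Matrix (Fin n) (Fin n) ℝ} (hS : S.PosDef)
    (h : (1 + (1 / 4 : ℝ) • ((CFC.sqrt S)⁻¹ * F * (CFC.sqrt S)⁻¹) ^ 2).PosDef) :
    (S + (1 / 4 : ℝ) • (F * S⁻¹ * F)).PosDef := by
  set T := CFC.sqrt S with hT
  have hTT : T * T = S := CFC.sqrt_mul_sqrt_self S (Matrix.nonneg_iff_posSemidef.mpr hS.posSemidef)
  have hTh : T.conjTranspose = T :=
    (Matrix.nonneg_iff_posSemidef.mp (CFC.sqrt_nonneg S)).isHermitian.eq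
  have hTu : IsUnit T.det := by
    rw [isUnit_iff_ne_zero]
    intro h0
    have := hS.det_pos
    rw [← hTT, Matrix.det_mul, h0] at this
    simp at this
  have h2 := h.conjTranspose_mul_mul_same (B := T)
    (Matrix.mulVec_injective_iff_isUnit.mpr ((Matrix.isUnit_iff_isUnit_det T).mpr hTu))
  convert h2 using 1
  have a1 := Matrix.mul_nonsing_inv _ hTu
  have a2 := Matrix.nonsing_inv_mul _ hTu
  have hSi : S⁻¹ = T⁻¹ * T⁻¹ := by rw [← hTT, Matrix.mul_inv_rev]
  rw [hTh, hSi, pow_two, Matrix.mul_add, Matrix.add_mul, Matrix.mul_one, hTT, Matrix.mul_smul,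
    Matrix.smul_mul]
  congr 2
  symm
  calc T * (T⁻¹ * F * T⁻¹ * (T⁻¹ * F * T⁻¹)) * T
      = (T * T⁻¹) * F * (T⁻¹ * T⁻¹) * F * (T⁻¹ * T) := by simp only [Matrix.mul_assoc]
    _ = _ := by rw [a1, a2, Matrix.one_mul, Matrix.mul_one]

/-! ### Calculus of matrix-valued functions -/

section MatrixCalculus

set_option linter.unusedSectionVars false

variable {ι : Type*} [Fintype ι] [DecidableEq ι] {l m k : Type*}

/-- The entrywise partial derivative of a matrix-valued function. -/
def pdMatrix (a : ι) (M : (ι → ℝ) → Matrix l m ℂ) (x : ι → ℝ) : Matrix l m ℂ :=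
  Matrix.of fun i j => pd a (fun y => M y i j) x

theorem pdMatrix_apply (a : ι) (M : (ι → ℝ) → Matrix l m ℂ) (x : ι → ℝ) (i : l) (j : m) :
    pdMatrix a M x i j = pd a (fun y => M y i j) x := rfl

theorem pd_ofReal {f : (ι → ℝ) → ℝ} {x : ι → ℝ} (hf : DifferentiableAt ℝ f x) (a : ι) :
    pd a (fun y => ((f y : ℝ) : ℂ)) x = ((pd a f x : ℝ) : ℂ) := by
  have h : HasFDerivAt (fun y => ((f y : ℝ) : ℂ)) (Complex.ofRealCLM.comp (fderiv ℝ f x)) x :=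
    Complex.ofRealCLM.hasFDerivAt.comp x hf.hasFDerivAt
  rw [pd, h.fderiv]
  rfl

theorem pdMatrix_mul [Fintype m] {M : (ι → ℝ) → Matrix l m ℂ} {N : (ι → ℝ) → Matrix m k ℂ}
    {x : ι → ℝ} (hM : ∀ i j, DifferentiableAt ℝ (fun y => M y i j) x)
    (hN : ∀ i j, DifferentiableAt ℝ (fun y => N y i j) x) (a : ι) :
    pdMatrix a (fun y => M y * N y) x = pdMatrix a M x * N x + M x * pdMatrix a N x := by
  ext i j
  simp only [pdMatrix_apply, Matrix.add_apply, Matrix.mul_apply, ← Finset.sum_add_distrib]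
  have h : HasFDerivAt (fun y => ∑ b, M y i b * N y b j) _ x :=
    HasFDerivAt.fun_sum fun b _ => (hM i b).hasFDerivAt.mul (hN b j).hasFDerivAt
  rw [pd, h.fderiv, sum_apply]
  refine Finset.sum_congr rfl fun b _ => ?_
  simp [pd]
  ring

theorem pdMatrix_congr {M N : (ι → ℝ) → Matrix l m ℂ} {x : ι → ℝ} (h : ∀ᶠ y in nhds x, M y = N y)
    (a : ι) : pdMatrix a M x = pdMatrix a N x := by
  ext i j
  have : (fun y => M y i j) =ᶠ[nhds x] fun y => N y i j := by
    filter_upwards [h] with y hy; rw [hy]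
  rw [pdMatrix_apply, pdMatrix_apply, pd, pd, this.fderiv_eq]

theorem pdMatrix_const (M : Matrix l m ℂ) (x : ι → ℝ) (a : ι) :
    pdMatrix a (fun _ => M) x = 0 := by
  ext i j; simp [pdMatrix_apply, pd]

theorem pdMatrix_add_const (M : (ι → ℝ) → Matrix l m ℂ) (N : Matrix l m ℂ) (x : ι → ℝ) (a : ι) :
    pdMatrix a (fun y => M y + N) x = pdMatrix a M x := by
  ext i j; simp [pdMatrix_apply, pd]

theorem pdMatrix_transpose (M : (ι → ℝ) → Matrix l m ℂ) (x : ι → ℝ) (a : ι) :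
    pdMatrix a (fun y => (M y).transpose) x = (pdMatrix a M x).transpose := rfl

theorem pd_det [Fintype m] [DecidableEq m] {M : (ι → ℝ) → Matrix m m ℂ} {x : ι → ℝ}
    (hM : ∀ i j, DifferentiableAt ℝ (fun y => M y i j) x) (a : ι) :
    pd a (fun y => (M y).det) x = ∑ i, ((M x).updateRow i (pdMatrix a M x i)).det := by
  -- The determinant as a real multilinear function of the rows, whose derivative is the sum over
  -- the rows of replacing one by its increment.
  let D : ContinuousMultilinearMap ℝ (fun _ : m => m → ℂ) ℂ :=
    ⟨(Matrix.detRowAlternating (R := ℂ) (n := m)).toMultilinearMap.restrictScalars ℝ,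
      by
        change Continuous fun A : m → m → ℂ => Matrix.det (Matrix.of A)
        fun_prop⟩
  have hd : HasFDerivAt (fun y i j => M y i j)
      (ContinuousLinearMap.pi fun i => ContinuousLinearMap.pi fun j =>
        fderiv ℝ (fun y => M y i j) x) x := by
    rw [hasFDerivAt_pi]
    intro i
    rw [hasFDerivAt_pi]
    exact fun j => (hM i j).hasFDerivAt
  have h := (D.hasFDerivAt (fun i j => M x i j)).comp x hd
  have e : (fun y => (M y).det) = D ∘ fun y i j => M y i j := rfl
  rw [pd, e, h.fderiv]
  simp only [ContinuousLinearMap.comp_apply, ContinuousMultilinearMap.linearDeriv_apply]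
  rfl

end MatrixCalculus

/-! ### The Bismut connection of `g + b` -/

section Bismut

set_option linter.unusedSectionVars false

variable {ι : Type*} [Fintype ι] [DecidableEq ι]

/-- The Koszul expression of `g` and `H = db` carry the same prefactor, and each derivative of `g`
pairs with one of `b` into a derivative of `e = g + b`. The order of the indices of `e` encodes the
torsion. -/
theorem bismutPlus_eq {e : (ι → ℝ) → Matrix ι ι ℝ} {x : ι → ℝ}
    (he : ∀ i j, DifferentiableAt ℝ (fun y => e y i j) x) (i j k : ι) :
    bismutPlus (fun y => (1 / 2 : ℝ) • (e y + (e y).transpose))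
      (dTwoForm fun y => (1 / 2 : ℝ) • (e y - (e y).transpose)) x i j k =
      (1 / 2) * ∑ l, ((1 / 2 : ℝ) • (e x + (e x).transpose))⁻¹ k l *
        (pd i (fun y => e y j l) x + pd j (fun y => e y l i) x - pd l (fun y => e y j i) x) := by
  have h1 : ∀ a p q, pd a (fun y => ((1 / 2 : ℝ) • (e y + (e y).transpose)) p q) x =
      1 / 2 * (pd a (fun y => e y p q) x + pd a (fun y => e y q p) x) := by
    intro a p q
    have : HasFDerivAt (fun y => ((1 / 2 : ℝ) • (e y + (e y).transpose)) p q) _ x :=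
      ((he p q).hasFDerivAt.add (he q p).hasFDerivAt).const_mul (1 / 2)
    rw [pd, this.fderiv]; rfl
  have h2 : ∀ a p q, pd a (fun y => ((1 / 2 : ℝ) • (e y - (e y).transpose)) p q) x =
      1 / 2 * (pd a (fun y => e y p q) x - pd a (fun y => e y q p) x) := by
    intro a p q
    have : HasFDerivAt (fun y => ((1 / 2 : ℝ) • (e y - (e y).transpose)) p q) _ x :=
      ((he p q).hasFDerivAt.sub (he q p).hasFDerivAt).const_mul (1 / 2)
    rw [pd, this.fderiv]; rfl
  simp only [bismutPlus, leviCivita, dTwoForm, h1, h2]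
  rw [← mul_add, ← Finset.sum_add_distrib]
  congr 1
  refine Finset.sum_congr rfl fun l _ => ?_
  ring

/-- The identity behind `∇^+_X Y = 0`, in terms of the values `de`, `dY`, `dR`, `dη` of the partial
derivatives at a point of `e = g + b`, of the frame `Y`, and of the factors in `e + √-1 Ω = R η`. -/
theorem lowered_parallel {κ : Type*} [Fintype κ] (X : ι → ℂ)
    (e Ω : Matrix ι ι ℂ) (hΩ : Ω.transpose = -Ω) (de : ι → Matrix ι ι ℂ)
    (Y : Matrix ι κ ℂ) (dY : ι → Matrix ι κ ℂ) (R : Matrix ι κ ℂ) (dR : ι → Matrix ι κ ℂ)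
    (η : Matrix κ ι ℂ) (dη : ι → Matrix κ ι ℂ)
    (hR : e + Complex.I • Ω = R * η) (hdR : ∀ a, de a = dR a * η + R * dη a)
    (hY : ∀ a, (de a).transpose * Y + (e + Complex.I • Ω).transpose * dY a = 0)
    (hηY : ∀ a, dη a * Y + η * dY a = 0) (hηX : η.mulVec X = 0)
    (hclosed : ∀ a b q, dη a q b = dη b q a) (l : ι) (q : κ) :
    ∑ a, X a * (((e + e.transpose) * dY a) l q +
      ∑ j, Y j q * (de a j l + de j l a - de l j a)) = 0 := by
  have hX : (e + Complex.I • Ω).mulVec X = 0 := by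
    rw [hR, ← Matrix.mulVec_mulVec, hηX, Matrix.mulVec_zero]
  -- the term with `∂_l e`
  have t4 : ∑ a, X a * ∑ j, Y j q * de l j a = 0 := by
    -- Differentiating `(e + √-1 Ω)ᵀ Y = 0` moves the derivative onto `Y`; pairing with `X` then
    -- gives zero because `(e + √-1 Ω) X = R η X = 0`.
    have h : ∀ a, ∑ j, Y j q * de l j a =
        - ∑ j, (e + Complex.I • Ω) j a * dY l j q := by
      intro a
      have := congrFun (congrFun (hY l) a) q
      simp only [Matrix.add_apply, Matrix.mul_apply, Matrix.transpose_apply, Matrix.zero_apply,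
        Matrix.smul_apply] at this
      rw [eq_neg_iff_add_eq_zero, ← this]
      simp only [Matrix.add_apply, Matrix.smul_apply, mul_comm (Y _ q)]
    simp only [h, mul_neg, Finset.sum_neg_distrib, Finset.mul_sum]
    rw [Finset.sum_comm, neg_eq_zero]
    refine Finset.sum_eq_zero fun j _ => ?_
    have := congrFun hX j
    simp only [Matrix.mulVec, dotProduct, Pi.zero_apply] at this
    calc _ = (∑ a, (e + Complex.I • Ω) j a * X a) * dY l j q := by
          rw [Finset.sum_mul]; exact Finset.sum_congr rfl fun a _ => by ring
      _ = 0 := by rw [this, zero_mul]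
  -- the term with `∂_j e`
  have t3 : ∑ a, X a * ∑ j, Y j q * de j l a = ∑ a, X a * (R * (dη a * Y)) l q := by
    -- Only `R ∂_j η` survives on `X`, as `η X = 0`. Closedness of `η` then exchanges the derivative
    -- index `j` with the index contracted with `X`.
    have h : ∀ j, ∑ a, de j l a * X a = ∑ p, R l p * ∑ a, dη j p a * X a := by
      intro j
      have := congrArg (fun M => M.mulVec X l) (hdR j)
      simp only [Matrix.add_mulVec, ← Matrix.mulVec_mulVec, hηX, Matrix.mulVec_zero, zero_add] at this
      exact this
    calc _ = ∑ j, Y j q * ∑ a, de j l a * X a := by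
          simp only [Finset.mul_sum]
          rw [Finset.sum_comm]
          exact Finset.sum_congr rfl fun j _ => Finset.sum_congr rfl fun a _ => by ring
      _ = ∑ j, Y j q * ∑ p, R l p * ∑ a, dη a p j * X a := by
          simp only [h, hclosed]
      _ = _ := by
          simp only [Matrix.mul_apply, Finset.mul_sum]
          rw [Finset.sum_comm]
          conv_rhs => rw [Finset.sum_comm]
          refine Finset.sum_congr rfl fun p _ => ?_
          rw [Finset.sum_comm]
          exact Finset.sum_congr rfl fun a _ => Finset.sum_congr rfl fun j _ => by ring
  -- Replacing `(∂_a e)ᵀ Y` by `-(e + √-1 Ω)ᵀ ∂_a Y` leaves `(e + √-1 Ω) ∂_a Y = R η ∂_a Y`, since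
  -- `Ω` is antisymmetric; and `η ∂_a Y = -(∂_a η) Y`. This cancels `t3`.
  have t12 : ∀ a, ((e + e.transpose) * dY a) l q + ∑ j, Y j q * de a j l =
      - (R * (dη a * Y)) l q := by
    intro a
    have h1 := congrFun (congrFun (hY a) l) q
    have h2 : (e + Complex.I • Ω) * dY a = - (R * (dη a * Y)) := by
      rw [hR, Matrix.mul_assoc, eq_neg_of_add_eq_zero_right (hηY a), Matrix.mul_neg]
    have h3 := congrFun (congrFun h2 l) q
    rw [Matrix.neg_apply] at h3
    rw [← h3]
    have h4 : ∑ j, Y j q * de a j l = ((de a).transpose * Y) l q := by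
      simp [Matrix.mul_apply, mul_comm]
    rw [h4]
    rw [Matrix.transpose_add, Matrix.transpose_smul, hΩ] at h1
    simp only [Matrix.add_mul, Matrix.add_apply, Matrix.smul_mul, Matrix.smul_apply, Matrix.neg_mul,
      Matrix.neg_apply, smul_neg, Matrix.zero_apply] at h1 ⊢
    linear_combination h1
  calc _ = ∑ a, X a * (((e + e.transpose) * dY a) l q + ∑ j, Y j q * de a j l) +
        ∑ a, X a * ∑ j, Y j q * de j l a - ∑ a, X a * ∑ j, Y j q * de l j a := by
        rw [← Finset.sum_add_distrib, ← Finset.sum_sub_distrib]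
        refine Finset.sum_congr rfl fun a _ => ?_
        simp only [mul_sub, mul_add, Finset.sum_sub_distrib, Finset.sum_add_distrib]
        ring
    _ = 0 := by
        rw [t4, t3, ← Finset.sum_add_distrib, sub_zero]
        refine Finset.sum_eq_zero fun a _ => ?_
        rw [t12]; ring

end Bismut

/-! ### Parallel frames and their wedge products. -/

section Parallel

set_option linter.unusedSectionVars false

variable {ι : Type*} [Fintype ι] [DecidableEq ι]

theorem pdMatrix_complexify {l m : Type*} {M : (ι → ℝ) → Matrix l m ℝ} {x : ι → ℝ}
    (hM : ∀ i j, DifferentiableAt ℝ (fun y => M y i j) x) (a : ι) (i : l) (j : m) :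
    pdMatrix a (fun y => complexify (M y)) x i j = ((pd a (fun y => M y i j) x : ℝ) : ℂ) := by
  rw [pdMatrix_apply]
  exact pd_ofReal (hM i j) a

/-- If `e = g + b` satisfies `e + √-1 Ω = R η` with closed `1`-forms `η`, the frame `Y` dual to `η` with
`(e + √-1 Ω)(Y, ·) = 0` is parallel for `∇^+` in the directions `X` annihilated by `η`. -/
theorem covDeriv_frame_eq_zero {κ : Type*} [Fintype κ] [DecidableEq κ] {X : ι → ℂ} {x : ι → ℝ}
    {e : (ι → ℝ) → Matrix ι ι ℝ} {Ω : Matrix ι ι ℝ} (hΩ : Ω.transpose = -Ω)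
    {Y R : (ι → ℝ) → Matrix ι κ ℂ} {η : (ι → ℝ) → Matrix κ ι ℂ}
    (hde : ∀ i j, DifferentiableAt ℝ (fun y => e y i j) x)
    (hdY : ∀ i j, DifferentiableAt ℝ (fun y => Y y i j) x)
    (hdR : ∀ i j, DifferentiableAt ℝ (fun y => R y i j) x)
    (hdη : ∀ i j, DifferentiableAt ℝ (fun y => η y i j) x)
    (hR : ∀ᶠ y in nhds x, complexify (e y) + Complex.I • complexify Ω = R y * η y)
    (hY : ∀ᶠ y in nhds x, (complexify (e y) + Complex.I • complexify Ω).transpose * Y y = 0)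
    (hηY : ∀ᶠ y in nhds x, η y * Y y = 1) (hηX : (η x).mulVec X = 0)
    (hclosed : ∀ a b q, pdMatrix a η x q b = pdMatrix b η x q a)
    (hg : IsUnit ((1 / 2 : ℝ) • (e x + (e x).transpose)).det) (k : ι) (q : κ) :
    ∑ a, X a * (pdMatrix a Y x k q + ∑ j, ((bismutPlus (fun y => (1 / 2 : ℝ) • (e y + (e y).transpose))
      (dTwoForm fun y => (1 / 2 : ℝ) • (e y - (e y).transpose)) x a j k : ℝ) : ℂ) * Y x j q) = 0 := by
  have hdE : ∀ i j, DifferentiableAt ℝ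
      (fun y => (complexify (e y) + Complex.I • complexify Ω) i j) x := by
    intro i j
    exact (Complex.ofRealCLM.differentiableAt.comp x (hde i j)).add_const _
  have key := lowered_parallel X (complexify (e x)) (complexify Ω)
    (by rw [← complexify_transpose, hΩ, complexify_neg])
    (fun a => pdMatrix a (fun y => complexify (e y)) x) (Y x) (fun a => pdMatrix a Y x)
    (R x) (fun a => pdMatrix a R x) (η x) (fun a => pdMatrix a η x) hR.self_of_nhds
    (fun a => by
      rw [← pdMatrix_mul hdR hdη, ← pdMatrix_congr hR, pdMatrix_add_const])
    (fun a => by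
      have := pdMatrix_mul (M := fun y => (complexify (e y) + Complex.I • complexify Ω).transpose)
        (fun i j => hdE j i) hdY a
      rw [pdMatrix_congr hY, pdMatrix_const, pdMatrix_transpose, pdMatrix_add_const] at this
      exact this.symm)
    (fun a => by rw [← pdMatrix_mul hdη hdY, pdMatrix_congr hηY, pdMatrix_const])
    hηX hclosed
  set G := (1 / 2 : ℝ) • (e x + (e x).transpose) with hG
  have hGc : complexify (e x) + (complexify (e x)).transpose = (2 : ℂ) • complexify G := by
    rw [hG, complexify_smul, complexify_add, complexify_transpose, smul_smul]
    norm_num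
  have hinv : ∀ a, pdMatrix a Y x k q =
      ∑ l, (complexify G⁻¹) k l * (complexify G * pdMatrix a Y x) l q := by
    intro a
    rw [← Matrix.mul_apply, ← Matrix.mul_assoc, complexify_inv_mul hg, Matrix.one_mul]
  have hΓ : ∀ a j, ((bismutPlus (fun y => (1 / 2 : ℝ) • (e y + (e y).transpose))
      (dTwoForm fun y => (1 / 2 : ℝ) • (e y - (e y).transpose)) x a j k : ℝ) : ℂ) =
      ∑ l, (complexify G⁻¹) k l * ((1 / 2) * (pdMatrix a (fun y => complexify (e y)) x j l +
        pdMatrix j (fun y => complexify (e y)) x l a -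
        pdMatrix l (fun y => complexify (e y)) x j a)) := by
    intro a j
    rw [bismutPlus_eq hde, ← hG]
    simp only [pdMatrix_complexify hde, complexify_apply]
    push_cast
    rw [Finset.mul_sum]
    exact Finset.sum_congr rfl fun l _ => by ring
  calc _ = ∑ l, (complexify G⁻¹) k l * ((1 / 2) *
        ∑ a, X a * (((complexify (e x) + (complexify (e x)).transpose) * pdMatrix a Y x) l q +
      ∑ j, Y x j q * (pdMatrix a (fun y => complexify (e y)) x j l +
        pdMatrix j (fun y => complexify (e y)) x l a -
        pdMatrix l (fun y => complexify (e y)) x j a))) := by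
        simp only [hGc, Finset.mul_sum]
        rw [Finset.sum_comm]
        refine Finset.sum_congr rfl fun a _ => ?_
        rw [hinv a]
        simp only [hΓ, Finset.sum_mul]
        rw [Finset.sum_comm, ← Finset.sum_add_distrib, Finset.mul_sum]
        refine Finset.sum_congr rfl fun l _ => ?_
        rw [Matrix.smul_mul, Matrix.smul_apply, smul_eq_mul, mul_add, mul_add, mul_add, mul_add,
          Finset.mul_sum, Finset.mul_sum, Finset.mul_sum, Finset.mul_sum]
        congr 1
        · ring
        · exact Finset.sum_congr rfl fun j _ => by ring
    _ = 0 := by simp [key]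

/-- The wedge evaluated on `α` is `det(α Y)`. Differentiating row by row matches the Leibniz terms
one by one, since `∇_X Y = 0` gives `α_m(X Y_q) = (∇_X α_m)(Y_q)`. -/
theorem covDerivMultiVector_wedge_eq_zero {n : ℕ} {Γ : (ι → ℝ) → ι → ι → ι → ℝ}
    {Y : (ι → ℝ) → Matrix ι (Fin n) ℂ} {x : ι → ℝ} {X : ι → ℂ}
    (hdY : ∀ i j, DifferentiableAt ℝ (fun y => Y y i j) x)
    (hΓ : ∀ k q, ∑ a, X a * (pdMatrix a Y x k q + ∑ j, (Γ x a j k : ℂ) * Y x j q) = 0)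
    (α : Fin n → ι → ℂ) :
    covDerivMultiVector Γ (fun y => wedge fun i a => Y y a i) x X α = 0 := by
  have hM : ∀ y, (wedge fun i a => Y y a i) α = (Matrix.of α * Y y).det := fun y => by
    rw [wedge_apply]; rfl
  have hdM : ∀ i j, DifferentiableAt ℝ (fun y => (Matrix.of α * Y y) i j) x := by
    intro i j
    simp only [Matrix.mul_apply]
    exact DifferentiableAt.fun_sum fun a _ => (hdY a j).const_mul _
  have hp : ∀ a, pdMatrix a (fun y => Matrix.of α * Y y) x = Matrix.of α * pdMatrix a Y x := by
    intro a
    rw [pdMatrix_mul (M := fun _ => Matrix.of α) (fun i j => differentiableAt_const _) hdY,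
      pdMatrix_const, Matrix.zero_mul, zero_add]
  rw [covDerivMultiVector, sub_eq_zero]
  simp only [hM, pd_det hdM, hp, Finset.mul_sum]
  rw [Finset.sum_comm]
  refine Finset.sum_congr rfl fun m _ => ?_
  -- Linearity in row `m` brings the sum over directions inside the determinant.
  have hsum : ∀ (s : Finset ι), ∑ a ∈ s, X a * ((Matrix.of α * Y x).updateRow m
      ((Matrix.of α * pdMatrix a Y x) m)).det = ((Matrix.of α * Y x).updateRow m
        fun j => ∑ a ∈ s, X a * (Matrix.of α * pdMatrix a Y x) m j).det := by
    intro s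
    induction s using Finset.induction_on with
    | empty =>
      rw [Finset.sum_empty]
      exact (Matrix.det_eq_zero_of_row_eq_zero m fun j => by simp).symm
    | insert b s hb ih =>
      rw [Finset.sum_insert hb, ih, ← Matrix.det_updateRow_smul, ← Matrix.det_updateRow_add]
      congr 2
      ext j
      simp [Finset.sum_insert hb]
  rw [hsum, wedge_apply]
  congr 1
  ext i j
  by_cases hi : i = m
  · subst hi
    simp only [Matrix.updateRow_self, Matrix.mul_apply, Matrix.of_apply, Function.update_self,
      covDerivCovector]
    have h1 : ∀ k, ∑ a, X a * pdMatrix a Y x k j =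
        - ∑ a, X a * ∑ p, (Γ x a p k : ℂ) * Y x p j := by
      intro k
      rw [eq_neg_iff_add_eq_zero, ← Finset.sum_add_distrib, ← hΓ k j]
      exact Finset.sum_congr rfl fun a _ => by ring
    calc _ = ∑ k, α i k * ∑ a, X a * pdMatrix a Y x k j := by
          simp only [Finset.mul_sum]
          rw [Finset.sum_comm]
          exact Finset.sum_congr rfl fun k _ => Finset.sum_congr rfl fun a _ => by ring
      _ = _ := by
          simp only [h1, mul_neg, neg_mul, Finset.mul_sum, Finset.sum_mul, Finset.sum_neg_distrib]
          congr 1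
          rw [Finset.sum_comm]
          conv_rhs => rw [Finset.sum_comm]
          refine Finset.sum_congr rfl fun a _ => ?_
          rw [Finset.sum_comm]
          exact Finset.sum_congr rfl fun p _ => Finset.sum_congr rfl fun k _ => by ring
  · simp [Matrix.updateRow_ne hi, Matrix.mul_apply, Function.update_of_ne hi]

end Parallel

/-! ### Smoothness -/

section Smooth

variable {E : Type*} [NormedAddCommGroup E] [NormedSpace ℝ E] {𝕜 : Type*} [RCLike 𝕜]
  {l m k : Type*} {W : Set E}

/-- Smoothness on `W` of all entries of a matrix-valued function. -/
def EntrywiseSmoothOn (M : E → Matrix l m 𝕜) (W : Set E) : Prop :=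
  ∀ i j, ContDiffOn ℝ ∞ (fun y => M y i j) W

theorem EntrywiseSmoothOn.const (M : Matrix l m 𝕜) :
    EntrywiseSmoothOn (fun _ : E => M) W := fun _ _ => contDiffOn_const

theorem EntrywiseSmoothOn.add {M N : E → Matrix l m 𝕜} (hM : EntrywiseSmoothOn M W)
    (hN : EntrywiseSmoothOn N W) : EntrywiseSmoothOn (fun y => M y + N y) W :=
  fun i j => (hM i j).add (hN i j)

theorem EntrywiseSmoothOn.neg {M : E → Matrix l m 𝕜} (hM : EntrywiseSmoothOn M W) :
    EntrywiseSmoothOn (fun y => -M y) W := fun i j => (hM i j).neg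

theorem EntrywiseSmoothOn.sub {M N : E → Matrix l m 𝕜} (hM : EntrywiseSmoothOn M W)
    (hN : EntrywiseSmoothOn N W) : EntrywiseSmoothOn (fun y => M y - N y) W :=
  fun i j => (hM i j).sub (hN i j)

theorem EntrywiseSmoothOn.const_smul {M : E → Matrix l m 𝕜} (hM : EntrywiseSmoothOn M W) (c : 𝕜) :
    EntrywiseSmoothOn (fun y => c • M y) W := fun i j => contDiffOn_const.mul (hM i j)

theorem EntrywiseSmoothOn.mul [Fintype m] {M : E → Matrix l m 𝕜} {N : E → Matrix m k 𝕜}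
    (hM : EntrywiseSmoothOn M W) (hN : EntrywiseSmoothOn N W) :
    EntrywiseSmoothOn (fun y => M y * N y) W := by
  intro i j
  simp only [Matrix.mul_apply]
  exact ContDiffOn.sum fun a _ => (hM i a).mul (hN a j)

theorem EntrywiseSmoothOn.det [Fintype m] [DecidableEq m] {M : E → Matrix m m 𝕜}
    (hM : EntrywiseSmoothOn M W) : ContDiffOn ℝ ∞ (fun y => (M y).det) W := by
  simp only [Matrix.det_apply']
  exact ContDiffOn.sum fun σ _ => contDiffOn_const.mul (contDiffOn_prod fun i _ => hM _ _)

theorem EntrywiseSmoothOn.inv [Fintype m] [DecidableEq m] {M : E → Matrix m m 𝕜}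
    (hM : EntrywiseSmoothOn M W) (h : ∀ y ∈ W, (M y).det ≠ 0) :
    EntrywiseSmoothOn (fun y => (M y)⁻¹) W := by
  intro i j
  simp only [Matrix.inv_def, Matrix.smul_apply, Ring.inverse_eq_inv', smul_eq_mul,
    Matrix.adjugate_apply]
  refine (hM.det.inv h).mul (EntrywiseSmoothOn.det fun a b => ?_)
  by_cases ha : a = j
  · simp only [ha, Matrix.updateRow_self]; exact contDiffOn_const
  · simp only [Matrix.updateRow_ne ha]; exact hM a b

theorem EntrywiseSmoothOn.complexify {M : E → Matrix l m ℝ} (hM : EntrywiseSmoothOn M W) :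
    EntrywiseSmoothOn (fun y => ToricGK.complexify (M y)) W :=
  fun i j => Complex.ofRealCLM.contDiff.comp_contDiffOn (hM i j)

theorem EntrywiseSmoothOn.fromRows {M : E → Matrix l m 𝕜} {N : E → Matrix k m 𝕜}
    (hM : EntrywiseSmoothOn M W) (hN : EntrywiseSmoothOn N W) :
    EntrywiseSmoothOn (fun y => Matrix.fromRows (M y) (N y)) W := by
  rintro (i | i) j
  exacts [hM i j, hN i j]

theorem EntrywiseSmoothOn.fromCols {M : E → Matrix l m 𝕜} {N : E → Matrix l k 𝕜}
    (hM : EntrywiseSmoothOn M W) (hN : EntrywiseSmoothOn N W) :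
    EntrywiseSmoothOn (fun y => Matrix.fromCols (M y) (N y)) W := by
  rintro i (j | j)
  exacts [hM i j, hN i j]

theorem EntrywiseSmoothOn.differentiableAt {M : E → Matrix l m 𝕜} (hM : EntrywiseSmoothOn M W)
    {x : E} (hx : W ∈ nhds x) (i : l) (j : m) : DifferentiableAt ℝ (fun y => M y i j) x :=
  ((hM i j).contDiffAt hx).differentiableAt (by simp)

variable {n : ℕ}

theorem EntrywiseSmoothOn.endo {ψ : E → Matrix (Fin n) (Fin n) ℝ} (hψ : EntrywiseSmoothOn ψ W)
    (h : ∀ y ∈ W, (ψ y).det ≠ 0) (F : Matrix (Fin n) (Fin n) ℝ) :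
    EntrywiseSmoothOn (fun y => ToricGK.endo (ψ y) F) W := by
  refine ((EntrywiseSmoothOn.const _).mul ?_).mul (EntrywiseSmoothOn.const _)
  rintro (i | i) (j | j)
  exacts [contDiffOn_const, hψ i j, (hψ.inv h).neg i j, contDiffOn_const]

theorem EntrywiseSmoothOn.holCoframe {ψ : E → Matrix (Fin n) (Fin n) ℝ}
    (hψ : EntrywiseSmoothOn ψ W) (c : ℂ) (F : Matrix (Fin n) (Fin n) ℝ) :
    EntrywiseSmoothOn (fun y => ToricGK.holCoframe c (ψ y) F) W :=
  (EntrywiseSmoothOn.const _).fromCols ((EntrywiseSmoothOn.const _).sub (hψ.complexify.const_smul c))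

theorem EntrywiseSmoothOn.holFactor {ψ : E → Matrix (Fin n) (Fin n) ℝ}
    (hψ : EntrywiseSmoothOn ψ W) (h : ∀ y ∈ W, (ψ y).det ≠ 0) (c : ℂ)
    (F : Matrix (Fin n) (Fin n) ℝ) :
    EntrywiseSmoothOn (fun y => ToricGK.holFactor c (ψ y) F) W :=
  EntrywiseSmoothOn.fromRows ((((EntrywiseSmoothOn.const _).mul (hψ.inv h).complexify).const_smul
    _).neg.add (EntrywiseSmoothOn.const _)) (hψ.inv h).complexify.neg

theorem EntrywiseSmoothOn.hermitianPart {S : E → Matrix (Fin n) (Fin n) ℝ}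
    (hS : EntrywiseSmoothOn S W) (F : Matrix (Fin n) (Fin n) ℝ) :
    EntrywiseSmoothOn (fun y => ToricGK.hermitianPart (S y) F) W :=
  hS.complexify.add (EntrywiseSmoothOn.const _)

theorem EntrywiseSmoothOn.flatFrame {S : E → Matrix (Fin n) (Fin n) ℝ}
    (hS : EntrywiseSmoothOn S W) (C F : Matrix (Fin n) (Fin n) ℝ)
    (h : ∀ y ∈ W, (ToricGK.hermitianPart (S y) F).det ≠ 0) :
    EntrywiseSmoothOn (fun y => ToricGK.flatFrame (S y) C F) W :=
  EntrywiseSmoothOn.fromRows ((((hS.sub (EntrywiseSmoothOn.const C)).hermitianPart F).mul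
    ((hS.hermitianPart F).inv h)).const_smul _) (((hS.hermitianPart F).inv h).const_smul _)

end Smooth

/-! ### The Hessian -/

section Hessian

theorem contDiffOn_pd {ι : Type*} [Fintype ι] [DecidableEq ι] {U : Set (ι → ℝ)} (hU : IsOpen U)
    {f : (ι → ℝ) → ℝ} (hf : ContDiffOn ℝ ∞ f U) (a : ι) : ContDiffOn ℝ ∞ (pd a f) U :=
  (hf.fderiv_of_isOpen hU (by simp)).clm_apply contDiffOn_const

theorem pd_comm {ι : Type*} [Fintype ι] [DecidableEq ι] {U : Set (ι → ℝ)} (hU : IsOpen U)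
    {f : (ι → ℝ) → ℝ} (hf : ContDiffOn ℝ ∞ f U) {m : ι → ℝ} (hm : m ∈ U) (a b : ι) :
    pd a (pd b f) m = pd b (pd a f) m := by
  have hd : DifferentiableAt ℝ (fderiv ℝ f) m :=
    ((hf.fderiv_of_isOpen hU (m := ∞) (by simp)).contDiffAt (hU.mem_nhds hm)).differentiableAt
      (by simp)
  have h : ∀ a b, pd a (pd b f) m = fderiv ℝ (fderiv ℝ f) m (Pi.single a 1) (Pi.single b 1) := by
    intro a b
    have := (hd.hasFDerivAt.clm_apply (hasFDerivAt_const (Pi.single b (1 : ℝ)) m))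
    change fderiv ℝ (fun y => fderiv ℝ f y (Pi.single b 1)) m (Pi.single a 1) = _
    rw [this.fderiv]
    simp
  rw [h, h]
  exact ((hf.contDiffAt (hU.mem_nhds hm)).isSymmSndFDerivAt
    (by simpa using WithTop.coe_le_coe.mpr (le_top : (2 : ℕ∞) ≤ ⊤))) _ _

variable {n : ℕ} {U : Set (Fin n → ℝ)} {τ : (Fin n → ℝ) → ℝ}

theorem pd_hess_comm (hU : IsOpen U) (hτ : ContDiffOn ℝ ∞ τ U) {m : Fin n → ℝ} (hm : m ∈ U)
    (a b q : Fin n) :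
    pd a (fun y => hess τ y q b) m = pd b (fun y => hess τ y q a) m := by
  have h : ∀ c, (fun y => hess τ y q c) =ᶠ[nhds m] pd c (pd q τ) := by
    intro c
    filter_upwards [hU.mem_nhds hm] with y hy
    exact pd_comm hU hτ hy q c
  have h2 : ∀ c d, pd d (fun y => hess τ y q c) m = pd d (pd c (pd q τ)) m := by
    intro c d
    rw [pd, (h c).fderiv_eq, pd]
  rw [h2, h2, pd_comm hU (contDiffOn_pd hU hτ q) hm]

theorem entrywiseSmoothOn_hess (hU : IsOpen U) (hτ : ContDiffOn ℝ ∞ τ U) :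
    EntrywiseSmoothOn (hess τ) U :=
  fun i j => contDiffOn_pd hU (contDiffOn_pd hU hτ j) i

/-- The projection `(θ, μ) ↦ μ` as a continuous linear map. -/
def momentCLM (n : ℕ) : (Fin n ⊕ Fin n → ℝ) →L[ℝ] (Fin n → ℝ) :=
  ContinuousLinearMap.pi fun i => ContinuousLinearMap.proj (Sum.inr i)

theorem isOpen_moment (hU : IsOpen U) : IsOpen {x : Fin n ⊕ Fin n → ℝ | moment x ∈ U} :=
  hU.preimage (momentCLM n).continuous

theorem entrywiseSmoothOn_hess_moment (hU : IsOpen U) (hτ : ContDiffOn ℝ ∞ τ U) :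
    EntrywiseSmoothOn (fun x => hess τ (moment x)) {x : Fin n ⊕ Fin n → ℝ | moment x ∈ U} :=
  fun i j => (entrywiseSmoothOn_hess hU hτ i j).comp (momentCLM n).contDiff.contDiffOn
    fun _ hx => hx

theorem fderiv_comp_moment {f : (Fin n → ℝ) → ℝ} {x : Fin n ⊕ Fin n → ℝ}
    (hf : DifferentiableAt ℝ f (moment x)) :
    fderiv ℝ (fun y => f (moment y)) x = (fderiv ℝ f (moment x)).comp (momentCLM n) :=
  (HasFDerivAt.comp x hf.hasFDerivAt (momentCLM n).hasFDerivAt).fderiv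

theorem pd_inl_comp_moment {f : (Fin n → ℝ) → ℝ} {x : Fin n ⊕ Fin n → ℝ}
    (hf : DifferentiableAt ℝ f (moment x)) (a : Fin n) :
    pd (Sum.inl a) (fun y => f (moment y)) x = 0 := by
  have h : momentCLM n (Pi.single (Sum.inl a) 1) = 0 := by ext i; simp [momentCLM]
  rw [pd, fderiv_comp_moment hf, ContinuousLinearMap.comp_apply, h, map_zero]

theorem pd_inr_comp_moment {f : (Fin n → ℝ) → ℝ} {x : Fin n ⊕ Fin n → ℝ}
    (hf : DifferentiableAt ℝ f (moment x)) (a : Fin n) :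
    pd (Sum.inr a) (fun y => f (moment y)) x = pd a f (moment x) := by
  have h : momentCLM n (Pi.single (Sum.inr a) 1) = Pi.single a 1 := by
    ext i; simp [momentCLM, Pi.single_apply]
  rw [pd, fderiv_comp_moment hf, ContinuousLinearMap.comp_apply, h, pd]

/-- The `dθ` coefficients are constant, and the `dμ` coefficients are constants plus multiples of
the Hessian, which depends on `μ` alone and has totally symmetric derivatives. -/
theorem pdMatrix_holCoframe_closed (hU : IsOpen U) (hτ : ContDiffOn ℝ ∞ τ U)
    (c : ℂ) (C F : Matrix (Fin n) (Fin n) ℝ) {x : Fin n ⊕ Fin n → ℝ} (hx : moment x ∈ U)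
    (a b : Fin n ⊕ Fin n) (q : Fin n) :
    pdMatrix a (fun y => holCoframe c (phi τ C (moment y)) F) x q b =
      pdMatrix b (fun y => holCoframe c (phi τ C (moment y)) F) x q a := by
  have hd : ∀ j, DifferentiableAt ℝ (fun m => hess τ m q j) (moment x) :=
    fun j => (entrywiseSmoothOn_hess hU hτ).differentiableAt (hU.mem_nhds hx) q j
  have hd' : ∀ j, DifferentiableAt ℝ (fun y => hess τ (moment y) q j) x :=
    fun j => (entrywiseSmoothOn_hess_moment hU hτ).differentiableAt
      ((isOpen_moment hU).mem_nhds hx) q j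
  have h1 : ∀ a j, pdMatrix a (fun y => holCoframe c (phi τ C (moment y)) F) x q (Sum.inl j) = 0 := by
    intro a j
    simp [pdMatrix_apply, holCoframe, pd]
  have h2 : ∀ a j, pdMatrix a (fun y => holCoframe c (phi τ C (moment y)) F) x q (Sum.inr j) =
      -c * ((pd a (fun y => hess τ (moment y) q j) x : ℝ) : ℂ) := by
    intro a j
    have e : (fun y : Fin n ⊕ Fin n → ℝ => holCoframe c (phi τ C (moment y)) F q (Sum.inr j)) =
        fun y => -c * ((hess τ (moment y) q j : ℝ) : ℂ) +
          (-(1 / 2 * (F q j : ℂ)) - c * (C q j : ℂ)) := by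
      ext y
      simp [holCoframe, phi]
      ring
    rw [← pd_ofReal (hd' j), pdMatrix_apply, e, pd, fderiv_add_const, fderiv_const_mul]
    · rfl
    · exact Complex.ofRealCLM.differentiableAt.comp x (hd' j)
  rcases a with a | a <;> rcases b with b | b
  · rw [h1, h1]
  · rw [h1, h2, pd_inl_comp_moment (f := fun m => hess τ m q b) (hd b)]; simp
  · rw [h1, h2, pd_inl_comp_moment (f := fun m => hess τ m q a) (hd a)]; simp
  · rw [h2, h2, pd_inr_comp_moment (f := fun m => hess τ m q b) (hd b),
      pd_inr_comp_moment (f := fun m => hess τ m q a) (hd a), pd_hess_comm hU hτ hx]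

end Hessian

/-! ### The metric, the `2`-form and the frame `∂_{z^+}` -/

section Frame

variable {n : ℕ} {τ : (Fin n → ℝ) → ℝ} {C F : Matrix (Fin n) (Fin n) ℝ}

theorem omega_transpose : (omega n).transpose = -omega n := by
  simp [omega, Matrix.fromBlocks_transpose, Matrix.fromBlocks_neg]

theorem isUnit_det_omega : IsUnit (omega n).det := by
  apply Matrix.isUnit_det_of_left_inverse (B := -omega n)
  simp [omega, Matrix.fromBlocks_neg, Matrix.fromBlocks_multiply]

theorem Jplus_transpose_mul_omega (hF : F.transpose = -F) (x : Fin n ⊕ Fin n → ℝ) :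
    (Jplus τ C F x).transpose * omega n = -(omega n * Jminus τ C F x) :=
  transpose_endo_mul_omega _ F hF

theorem metric_eq (hF : F.transpose = -F) (x : Fin n ⊕ Fin n → ℝ) :
    metric τ C F x = (1 / 2 : ℝ) • (omega n * Jminus τ C F x +
      (omega n * Jminus τ C F x).transpose) := by
  rw [metric, Matrix.transpose_add, Matrix.add_mul, Jplus_transpose_mul_omega hF,
    Matrix.transpose_mul, omega_transpose, Matrix.mul_neg]
  module

theorem bField_eq (hF : F.transpose = -F) (x : Fin n ⊕ Fin n → ℝ) :
    bField τ C F x = (1 / 2 : ℝ) • (omega n * Jminus τ C F x -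
      (omega n * Jminus τ C F x).transpose) := by
  rw [bField, Matrix.transpose_sub, Matrix.sub_mul, Jplus_transpose_mul_omega hF,
    Matrix.transpose_mul, omega_transpose, Matrix.mul_neg]
  module

theorem phi_transpose {m : Fin n → ℝ} (hS : (hess τ m).transpose = hess τ m)
    (hC : C.transpose = -C) : (phi τ C m).transpose = hess τ m - C := by
  rw [phi, Matrix.transpose_add, hS, hC, sub_eq_add_neg]

theorem Jplus_eq {x : Fin n ⊕ Fin n → ℝ} (hS : (hess τ (moment x)).transpose = hess τ (moment x))
    (hC : C.transpose = -C) : Jplus τ C F x = endo (hess τ (moment x) - C) F := by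
  rw [Jplus, phi_transpose hS hC]

theorem isUnit_det_metric {x : Fin n ⊕ Fin n → ℝ}
    (hS : (hess τ (moment x)).transpose = hess τ (moment x)) (hC : C.transpose = -C)
    (hA : IsUnit (hess τ (moment x) - C).det) (hB : IsUnit (hess τ (moment x) + C).det)
    (h : IsUnit (hermitianPart (hess τ (moment x)) F).det) :
    IsUnit (metric τ C F x).det := by
  rw [metric, ← smul_neg, ← Matrix.neg_mul, ← neg_one_smul ℝ (Matrix.transpose _),
    Matrix.smul_mul, smul_smul, Matrix.det_smul, Matrix.det_mul, Matrix.det_transpose, Jplus_eq hS hC]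
  exact (IsUnit.pow _ (by norm_num)).mul ((isUnit_det_endo_add_endo hA hB h).mul isUnit_det_omega)

/-- Both are frames of `T^{1,0}_+`. Comparing `∂_μ` components, `(√-1/2)(φᵀ)⁻¹` against `(√-1/2)
E⁻¹` with `E = S + (√-1/2) F`, forces the transition matrix. -/
theorem delzPlus_eq {x : Fin n ⊕ Fin n → ℝ}
    (hS : (hess τ (moment x)).transpose = hess τ (moment x)) (hC : C.transpose = -C)
    (hA : IsUnit (hess τ (moment x) - C).det)
    (h : IsUnit (hermitianPart (hess τ (moment x)) F).det) (i : Fin n) (a : Fin n ⊕ Fin n) :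
    delzPlus τ C F x i a = (flatFrame (hess τ (moment x)) C F *
      (hermitianPart (hess τ (moment x)) F * complexify (hess τ (moment x) - C)⁻¹)) a i := by
  rw [flatFrame, ← Matrix.mul_assoc, Matrix.fromRows_mul, Matrix.smul_mul, Matrix.smul_mul,
    Matrix.mul_assoc, Matrix.nonsing_inv_mul _ h, Matrix.mul_one, Matrix.fromRows_mul,
    Matrix.smul_mul, Matrix.smul_mul, Matrix.one_mul, delzPlus, Jplus_eq hS hC, endo_eq_fromBlocks]
  rw [hermitianPart, Matrix.add_mul, complexify_mul_inv hA, Matrix.smul_mul, ← complexify_mul]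
  rcases a with a | a
  · by_cases hai : a = i <;> simp [actC, hai] <;> ring
  · simp [actC]
    ring

theorem wedge_mul (Y : Matrix (Fin n ⊕ Fin n) (Fin n) ℂ) (N : Matrix (Fin n) (Fin n) ℂ) :
    wedge (fun i a => (Y * N) a i) = N.det • wedge (fun i a => Y a i) := by
  ext α
  have h : ∀ Y : Matrix (Fin n ⊕ Fin n) (Fin n) ℂ,
      wedge (fun i a => Y a i) α = (Matrix.of α * Y).det := fun Y => by
    rw [wedge_apply]; rfl
  rw [AlternatingMap.smul_apply, h, h, ← Matrix.mul_assoc, Matrix.det_mul, smul_eq_mul, mul_comm]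

theorem eps_mul_det {m : Fin n → ℝ} (hS : (hess τ m).PosDef) (hC : C.transpose = -C)
    (hF : F.transpose = -F) (hX : (Xi τ F m).PosDef) :
    (eps τ C F m : ℂ) *
      (hermitianPart (hess τ m) F * complexify (hess τ m - C)⁻¹).det = 1 := by
  have hSt : (hess τ m).transpose = hess τ m := by simpa using hS.isHermitian.eq
  have hd := det_hermitianPart_pos hS hF hX
  have hde : (hermitianPart (hess τ m) F).det = ((hermitianPart (hess τ m) F).det.re : ℂ) :=
    Complex.ext rfl (det_hermitianPart_im hSt hF)
  have hsq := det_hermitianPart_sq hSt (isUnit_iff_ne_zero.mpr hS.det_pos.ne') hF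
  have hp : 0 < (phi τ C m).det := det_add_pos hS hC
  rw [Matrix.det_mul, det_complexify, ← phi_transpose hSt hC, Matrix.det_nonsing_inv,
    Ring.inverse_eq_inv', Matrix.det_transpose]
  rw [hde] at hsq ⊢
  set d := (hermitianPart (hess τ m) F).det.re
  have hsq' : (hess τ m * Xi τ F m).det = d ^ 2 := by
    rw [Xi]; exact_mod_cast hsq.symm
  -- The power `-1/2` of a square gives the inverse of an absolute value; positivity of both
  -- determinants removes the absolute value.
  have he : eps τ C F m = (d / (phi τ C m).det)⁻¹ := by
    rw [eps, hsq', ← div_pow, Real.rpow_neg (by positivity), ← Real.sqrt_eq_rpow,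
      Real.sqrt_sq (by positivity)]
  rw [he]
  norm_cast
  field_simp

end Frame

end ToricGK

end

/-! ### The theorem: `ε s_0^+` is the wedge of the flat frame. -/

theorem lemma6p5 {n : ℕ}
    -- the interior of the moment polytope, and the symplectic potential on it
    (U : Set (Fin n → ℝ)) (hU : IsOpen U)
    (τ : (Fin n → ℝ) → ℝ) (hτ : ContDiffOn ℝ ∞ τ U)
    (hpos : ∀ m ∈ U, (ToricGK.hess τ m).PosDef)
    (C F : Matrix (Fin n) (Fin n) ℝ) (hC : C.transpose = -C) (hF : F.transpose = -F)
    (hCF : ∀ m ∈ U,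
      (1 + (1 / 4 : ℝ) •
        ((CFC.sqrt (ToricGK.hess τ m))⁻¹ * F * (CFC.sqrt (ToricGK.hess τ m))⁻¹) ^ 2).PosDef) :
    ToricGK.IsHolomorphicSection {x | ToricGK.moment x ∈ U}
      (ToricGK.Jplus τ C F) (ToricGK.Jminus τ C F) (ToricGK.nablaPlus τ C F)
      (fun x => (ToricGK.eps τ C F (ToricGK.moment x) : ℂ) •
        ToricGK.wedge (ToricGK.delzPlus τ C F x)) := by
  open ToricGK in
  have hSt : ∀ m ∈ U, (hess τ m).transpose = hess τ m := fun m hm => by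
    simpa using (hpos m hm).isHermitian.eq
  have hXi : ∀ m ∈ U, (Xi τ F m).PosDef := fun m hm => posDef_add_of_sqrt (hpos m hm) (hCF m hm)
  have hB : ∀ m ∈ U, (phi τ C m).det ≠ 0 := fun m hm => (det_add_pos (hpos m hm) hC).ne'
  have hA : ∀ m ∈ U, IsUnit (hess τ m - C).det := fun m hm => by
    rw [← phi_transpose (hSt m hm) hC, Matrix.det_transpose]
    exact isUnit_iff_ne_zero.mpr (hB m hm)
  have hE : ∀ m ∈ U, (hermitianPart (hess τ m) F).det ≠ 0 := fun m hm h0 => by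
    have := det_hermitianPart_pos (hpos m hm) hF (hXi m hm)
    rw [h0] at this
    simp at this
  have hSm := entrywiseSmoothOn_hess_moment hU hτ
  have hφ : EntrywiseSmoothOn (fun x => phi τ C (moment x)) {x | moment x ∈ U} :=
    hSm.add (EntrywiseSmoothOn.const C)
  have hY := hSm.flatFrame C F fun y hy => hE _ hy
  have hsection : ∀ x ∈ {x : Fin n ⊕ Fin n → ℝ | moment x ∈ U},
      (eps τ C F (moment x) : ℂ) • wedge (delzPlus τ C F x) =
        wedge fun i a => flatFrame (hess τ (moment x)) C F a i := by
    intro x hx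
    have h : delzPlus τ C F x = fun i a => (flatFrame (hess τ (moment x)) C F *
        (hermitianPart (hess τ (moment x)) F * complexify (hess τ (moment x) - C)⁻¹)) a i := by
      ext i a
      exact delzPlus_eq (hSt _ hx) hC (hA _ hx) (isUnit_iff_ne_zero.mpr (hE _ hx)) i a
    rw [h, wedge_mul, smul_smul, eps_mul_det (hpos _ hx) hC hF (hXi _ hx), one_smul]
  refine ⟨?_, ?_, ?_⟩
  · intro x hx
    rw [hsection x hx]
    refine Submodule.subset_span ⟨_, fun i => ?_, rfl⟩
    rw [Jplus_eq (hSt _ hx) hC]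
    ext a
    exact congrFun (congrFun (endo_mul_flatFrame (hA _ hx) F) a) i
  · intro α
    -- Passing to the flat frame avoids differentiating the real power in `ε`.
    refine (EntrywiseSmoothOn.det ((EntrywiseSmoothOn.const (Matrix.of α)).mul hY)).congr ?_
    intro x hx
    rw [hsection x hx, wedge_apply]
    rfl
  · intro x hx X hX α
    have hnhds := (isOpen_moment hU).mem_nhds hx
    -- The two sections agree only over `U`; as this is open, they have the same value and the same
    -- derivatives at `x`.
    have hcong : covDerivMultiVector (nablaPlus τ C F)
        (fun x => (eps τ C F (moment x) : ℂ) • wedge (delzPlus τ C F x)) x X α =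
        covDerivMultiVector (nablaPlus τ C F)
          (fun x => wedge fun i a => flatFrame (hess τ (moment x)) C F a i) x X α := by
      have hev : (fun y => ((eps τ C F (moment y) : ℂ) • wedge (delzPlus τ C F y)) α) =ᶠ[nhds x]
          fun y => (wedge fun i a => flatFrame (hess τ (moment y)) C F a i) α := by
        filter_upwards [hnhds] with y hy
        rw [hsection y hy]
      simp only [covDerivMultiVector, pd, hev.fderiv_eq, hsection x hx]
    rw [hcong]
    have hnabla : nablaPlus τ C F = bismutPlus
        (fun y => (1 / 2 : ℝ) • (omega n * Jminus τ C F y + (omega n * Jminus τ C F y).transpose))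
        (dTwoForm fun y => (1 / 2 : ℝ) • (omega n * Jminus τ C F y -
          (omega n * Jminus τ C F y).transpose)) := by
      rw [nablaPlus]
      congr 1
      · exact funext fun y => metric_eq hF y
      · congr 1
        exact funext fun y => bField_eq hF y
    rw [hnabla]
    refine covDerivMultiVector_wedge_eq_zero
      (Y := fun y => flatFrame (hess τ (moment y)) C F) (hY.differentiableAt hnhds) ?_ α
    have hII : Complex.I * Complex.I = -1 := Complex.I_mul_I
    have hJm : EntrywiseSmoothOn (fun y => omega n * Jminus τ C F y) {x | moment x ∈ U} :=
      (EntrywiseSmoothOn.const _).mul (hφ.endo (fun y hy => hB _ hy) (-F))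
    refine covDeriv_frame_eq_zero (Ω := omega n)
      (R := fun y => complexify (omega n) * holFactor Complex.I (phi τ C (moment y)) (-F))
      (η := fun y => holCoframe Complex.I (phi τ C (moment y)) (-F))
      omega_transpose (hJm.differentiableAt hnhds) (hY.differentiableAt hnhds)
      (((EntrywiseSmoothOn.const _).mul
        (hφ.holFactor (fun y hy => hB _ hy) _ _)).differentiableAt hnhds)
      ((hφ.holCoframe _ _).differentiableAt hnhds) ?_ ?_ ?_ ?_ ?_ ?_
    · filter_upwards [hnhds] with y hy
      rw [Matrix.mul_assoc, holFactor_mul_holCoframe hII (isUnit_iff_ne_zero.mpr (hB _ hy)),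
        complexify_mul, Matrix.mul_add, Matrix.mul_smul, Matrix.mul_one]
      rfl
    · filter_upwards [hnhds] with y hy
      -- Since `ω J_- = -J_+ᵀ ω`, the transpose of `ω J_- + √-1 ω` is `ω (J_+ - √-1)`, which
      -- annihilates `T^{1,0}_+`.
      rw [← neg_eq_iff_eq_neg.mpr (Jplus_transpose_mul_omega hF y), Matrix.transpose_add,
        ← complexify_transpose, Matrix.transpose_neg, Matrix.transpose_mul,
        Matrix.transpose_transpose, Matrix.transpose_smul, ← complexify_transpose, omega_transpose,
        Matrix.neg_mul, neg_neg, complexify_mul, complexify_neg, Matrix.add_mul, Matrix.mul_assoc,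
        Jplus_eq (hSt _ hy) hC, endo_mul_flatFrame (hA _ hy), Matrix.mul_smul, Matrix.smul_mul,
        Matrix.neg_mul, smul_neg, add_neg_cancel]
    · filter_upwards [hnhds] with y hy
      exact holCoframe_mul_flatFrame (isUnit_iff_ne_zero.mpr (hE _ hy))
    · exact holCoframe_mulVec_eq_zero hII (isUnit_iff_ne_zero.mpr (hB _ hx)) _ hX
    · exact pdMatrix_holCoframe_closed hU hτ _ C (-F) hx
    · rw [← metric_eq hF]
      exact isUnit_det_metric (hSt _ hx) hC (hA _ hx) (isUnit_iff_ne_zero.mpr (hB _ hx))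
        (isUnit_iff_ne_zero.mpr (hE _ hx))
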